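/- Let $S:[0,\infty)\to\mathbb{R}$ be locally integrable on $[0,\infty)$ and let $a\in\mathbb{R}$. Write $\hat f(t)=\int_{-\infty}^{\infty}e^{-itx}f(x)\,\mathrm{d}x$, and let $A_c(\mathbb{R})$ be the set of compactly supported functions $\varphi:\mathbb{R}\to\mathbb{C}$ of the form $\varphi=\hat\psi$ with $\psi\in L^1(\mathbb{R})$. Let $\{\varphi_\lambda\}_{\lambda\in J}$ be a family of functions in $A_c(\mathbb{R})$ such that for every $t\in\mathbb{R}$ there is $\lambda_t\in J$ with $\varphi_{\lambda_t}(t)\neq 0$, where for $t=0$ the index $\lambda_0$ can be chosen so that moreover $\hat\varphi_{\lambda_0}(x)$ is real and non-negative for all $x\in\mathbb{R}$. Then $$S(x)\sim a e^{x}\quad (x\to\infty),\qquad\text{i.e. } \lim_{x\to\infty}e^{-x}S(x)=a,$$ if and only if the following three conditions hold: (i) $S$ is log-linearly slowly decreasing: for every $\varepsilon>0$ there exist $\delta>0$ and $x_0$ such that $\dfrac{S(x+h)-S(x)}{e^x}\ge-\varepsilon$ for all $0\le h\le\delta$ and $x\ge x_0$; (ii) the Laplace transform $\mathcal{L}\{S;s\}=\int_0^\infty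 e^{-sx}S(x)\,\mathrm{d}x=\lim_{R\to\infty}\int_0^R e^{-sx}S(x)\,\mathrm{d}x$ converges (possibly conditionally) for every $s\in\mathbb{C}$ with $\Re e\, s>1$; (iii) the function $G(s)=\mathcal{L}\{S;s\}-\dfrac{a}{s-1}$, which is analytic on $\Re e\, s>1$, has pseudofunction boundary behaviour on $\Re e\, s=1$ with respect to every $\varphi_\lambda$, $\lambda\in J$: for each $\lambda\in J$ there is $N>0$ such that $$I_{\lambda}(h)=\lim_{\sigma\to1^+}\int_{-\infty}^{\infty}G(\sigma+it)e^{iht}\varphi_\lambda(t)\,\mathrm{d}t$$ exists for every $h\ge N$, and $I_\lambda(h)\to0$ as $h\to\infty$. -/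

import Mathlib

open Filter Topology MeasureTheory

namespace WienerIkehara

noncomputable section

/-- The Fourier transform normalized as `∫ e^{-itx} f(x) dx`. -/
def fourierHat (f : ℝ → ℂ) (t : ℝ) : ℂ :=
  ∫ x : ℝ, Complex.exp (-(Complex.I * t * x)) * f x

/-- The space `A_c(ℝ)`: compactly supported functions in the Wiener algebra
`A(ℝ)`, the set of Fourier transforms of functions in `L¹(ℝ)`. -/
def MemWienerAlgebraCompact (φ : ℝ → ℂ) : Prop :=
  (∃ ψ : ℝ → ℂ, Integrable ψ ∧ φ = fourierHat ψ) ∧ HasCompactSupport φ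

/-- `S` is log-linearly slowly decreasing. -/
def LogLinearlySlowlyDecreasing (S : ℝ → ℝ) : Prop :=
  ∀ ε : ℝ, 0 < ε → ∃ δ : ℝ, 0 < δ ∧ ∃ x₀ : ℝ,
    ∀ x h : ℝ, x₀ ≤ x → 0 ≤ h → h ≤ δ → -ε ≤ (S (x + h) - S x) / Real.exp x

/-- The truncated Laplace integral `∫_0^R e^{-sx} S(x) dx`. -/
def laplacePartial (S : ℝ → ℝ) (s : ℂ) (R : ℝ) : ℂ :=
  ∫ x in (0 : ℝ)..R, Complex.exp (-(s * x)) * (S x : ℂ)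

/-- The Laplace integral of `S` converges (possibly only conditionally) at `s`. -/
def LaplaceConverges (S : ℝ → ℝ) (s : ℂ) : Prop :=
  ∃ L : ℂ, Tendsto (laplacePartial S s) atTop (𝓝 L)

/-- The Laplace transform of `S`, the value of the improper integral
`∫_0^∞ e^{-sx} S(x) dx` wherever it converges. -/
def laplaceTransform (S : ℝ → ℝ) (s : ℂ) : ℂ :=
  limUnder atTop (laplacePartial S s)

/-- `G` is analytic on the half-plane `Re s > α` and has pseudofunction boundary behaviour
on `Re s = α` with respect to `φ`: for some `N > 0` the limit
`I(h) = lim_{σ → α⁺} ∫ G(σ + it) e^{iht} φ(t) dt` exists for all `h ≥ N`,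
and `I(h) = o(1)` as `h → ∞`. -/
def PseudofunctionBoundaryBehaviorWrt (G : ℂ → ℂ) (α : ℝ) (φ : ℝ → ℂ) : Prop :=
  AnalyticOnNhd ℂ G {s : ℂ | α < s.re} ∧
  ∃ N : ℝ, 0 < N ∧ ∃ I : ℝ → ℂ,
    (∀ h : ℝ, N ≤ h →
      Tendsto (fun σ : ℝ => ∫ t : ℝ,
          G (σ + t * Complex.I) * Complex.exp (Complex.I * h * t) * φ t)
        (𝓝[>] α) (𝓝 (I h))) ∧
    Tendsto I atTop (𝓝 0)

end

end WienerIkehara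

/-!
Let `D x = e^{-x} S(x) - a` be the normalized error; the theorem says that `D` tends to zero exactly
when the three conditions hold. Whenever `e^{-ηx} D(x)` is integrable for all `η > 0`, the function
`G` is the Laplace transform of `D`, and Fubini's theorem (`integral_laplace_mul_eq`) rewrites
`∫ G(σ + it) e^{iht} φ(t) dt` as the average `∫ e^{-(σ - 1)x} D(x) φ̂(x - h) dx`. The kernels `φ̂`
are integrable, by Fourier inversion in `L¹`. If `D` is bounded near infinity, letting `σ → 1⁺`
shows that the boundary behaviour with respect to `φ` means precisely that the averages
`∫ D(x) φ̂(x - h) dx` tend to zero as `h → ∞` (`tendsto_integral_laplace_mul`,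
`tendsto_average_iff`). The direct implication follows.

For the converse, slow decrease first bounds `D` from below
(`LogLinearlySlowlyDecreasing.exists_normalizedError_ge`), so the Laplace integrals converge
absolutely. The function `φ` with `φ̂ ≥ 0` then gives bounded averages of `D` against a non-negative
kernel, and slow decrease turns this into an upper bound for `D`
(`exists_abs_normalizedError_le`). The averages of the bounded function `D` against kernels whose
Fourier transforms have no common zero tend to zero, so a Tauberian theorem of Wiener type
finishes the proof.

That theorem is proved without inverting anything in the Wiener algebra. Let `f` be bounded with
`f ⋆ k → 0` at infinity and `c = 𝓕 k u ≠ 0`, let `h` be a kernel with spectrum very close to `u`,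
and `m` one with `h ⋆ m = h` whose spectrum is slightly larger. Then `F = f ⋆ h` satisfies
`c F = F ⋆ (c m - k ⋆ m) + o(1)`, and `‖c m - k ⋆ m‖₁` is small, since on such a narrow spectrum
convolution with `k` is nearly multiplication by `c`
(`tendsto_integral_norm_fourier_mul_sub_convolution`). So `limsup |F| ≤ limsup |F| / 2`, and `F → 0`
(`exists_tendsto_convolution_of_fourier_ne_zero`). Smooth cutoffs extend this to every kernel whose
Fourier transform is a test function. Among these there is a non-negative one of positive mass,
together with all its dilations, and for slowly decreasing functions the corresponding averages
control the function itself (`tendsto_zero_of_tendsto_average`).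
-/

namespace WienerIkehara

/-! ### Convolution of a bounded function with an integrable kernel -/

section Convolution

open ContinuousLinearMap
open scoped Convolution

variable {f k g : ℝ → ℂ} {M : ℝ}

theorem convolutionExistsAt_of_bounded (hf : AEStronglyMeasurable f) (hM : ∀ x, ‖f x‖ ≤ M)
    (hk : Integrable k) (x : ℝ) : ConvolutionExistsAt f k x (mul ℂ ℂ) := by
  have h : Integrable fun t => f t * k (x - t) :=
    (hk.comp_sub_left x).bdd_mul hf (ae_of_all _ hM)
  exact h

theorem norm_convolution_le (hM : ∀ x, ‖f x‖ ≤ M) (hk : Integrable k) (x : ℝ) :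
    ‖(f ⋆[mul ℂ ℂ] k) x‖ ≤ M * ∫ y, ‖k y‖ := by
  rw [convolution_mul_swap, ← integral_const_mul]
  refine norm_integral_le_of_norm_le (hk.norm.const_mul M) (ae_of_all _ fun y => ?_)
  rw [norm_mul]
  gcongr
  exact hM _

/-- If `‖f‖` is bounded and eventually at most `L`, then `‖f ⋆ k‖` is eventually at most
`L ‖k‖₁ + ε`. -/
theorem eventually_norm_convolution_le (hf : AEStronglyMeasurable f) (hM : ∀ x, ‖f x‖ ≤ M)
    (hk : Integrable k) {L : ℝ} (hL : ∀ᶠ x in atTop, ‖f x‖ ≤ L) {ε : ℝ} (hε : 0 < ε) :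
    ∀ᶠ x in atTop, ‖(f ⋆[mul ℂ ℂ] k) x‖ ≤ L * (∫ y, ‖k y‖) + ε := by
  have hsub : ∀ x, AEStronglyMeasurable fun y => f (x - y) := fun x =>
    hf.comp_quasiMeasurePreserving (quasiMeasurePreserving_sub_left_of_right_invariant volume x)
  have hmax : ∀ z, ‖max ‖f z‖ L‖ ≤ max M |L| := fun z => by
    refine abs_le.2 ⟨?_, max_le_max (hM _) (le_abs_self L)⟩
    refine le_trans ?_ (le_max_right _ _)
    exact (neg_le_neg (le_max_right M |L|)).trans (neg_abs_le L)
  have hlim : Tendsto (fun x => ∫ y, max ‖f (x - y)‖ L * ‖k y‖) atTop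
      (𝓝 (∫ y, L * ‖k y‖)) := by
    refine tendsto_integral_filter_of_dominated_convergence (fun y => max M |L| * ‖k y‖)
      (Eventually.of_forall fun x =>
        ((hsub x).norm.sup aestronglyMeasurable_const).mul hk.1.norm)
      (Eventually.of_forall fun x => ae_of_all _ fun y => ?_)
      (hk.norm.const_mul _) (ae_of_all _ fun y => ?_)
    · rw [norm_mul, norm_norm]
      exact mul_le_mul_of_nonneg_right (hmax _) (norm_nonneg _)
    · refine tendsto_const_nhds.congr' ?_
      have : Tendsto (fun x : ℝ => x - y) atTop atTop :=
        tendsto_atTop_add_const_right _ _ tendsto_id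
      filter_upwards [this.eventually hL] with x hx
      rw [max_eq_right hx]
  rw [integral_const_mul] at hlim
  filter_upwards [hlim.eventually (gt_mem_nhds (lt_add_of_pos_right _ hε))] with x hx
  refine le_trans ?_ hx.le
  rw [convolution_mul_swap]
  refine norm_integral_le_of_norm_le (hk.norm.bdd_mul (c := max M |L|)
    ((hsub x).norm.sup aestronglyMeasurable_const) (ae_of_all _ fun y => hmax _))
    (ae_of_all _ fun y => ?_)
  rw [norm_mul]
  exact mul_le_mul_of_nonneg_right (le_max_left _ _) (norm_nonneg _)

theorem tendsto_convolution_zero (hf : AEStronglyMeasurable f) (hM : ∀ x, ‖f x‖ ≤ M)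
    (h0 : Tendsto f atTop (𝓝 0)) (hk : Integrable k) :
    Tendsto (f ⋆[mul ℂ ℂ] k) atTop (𝓝 0) := by
  rw [NormedAddGroup.tendsto_nhds_zero]
  intro ε hε
  have hK : 0 ≤ ∫ y, ‖k y‖ := integral_nonneg fun _ => norm_nonneg _
  have hL : ∀ᶠ x in atTop, ‖f x‖ ≤ ε / (2 * ((∫ y, ‖k y‖) + 1)) := by
    have := NormedAddGroup.tendsto_nhds_zero.1 h0 (ε / (2 * ((∫ y, ‖k y‖) + 1))) (by positivity)
    exact this.mono fun x hx => hx.le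
  filter_upwards [eventually_norm_convolution_le hf hM hk hL (show 0 < ε / 4 by positivity)]
    with x hx
  refine hx.trans_lt ?_
  have : ε / (2 * ((∫ y, ‖k y‖) + 1)) * (∫ y, ‖k y‖) ≤ ε / 2 := by
    rw [div_mul_eq_mul_div, div_le_div_iff₀ (by positivity) (by positivity)]
    nlinarith
  linarith

theorem convolution_assoc_of_bounded (hf : AEStronglyMeasurable f) (hM : ∀ x, ‖f x‖ ≤ M)
    (hk : Integrable k) (hg : Integrable g) :
    ((f ⋆[mul ℂ ℂ] k) ⋆[mul ℂ ℂ] g) = (f ⋆[mul ℂ ℂ] (k ⋆[mul ℂ ℂ] g)) := by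
  ext x
  refine convolution_assoc (mul ℂ ℂ) (mul ℂ ℂ) (mul ℂ ℂ) (mul ℂ ℂ)
    (fun a b c => by simp [mul_assoc]) hf hk.1 hg.1
    (ae_of_all _ fun y => convolutionExistsAt_of_bounded hf hM hk y)
    (hk.norm.ae_convolution_exists (mul ℝ ℝ) hg.norm) ?_
  have h : Integrable fun t => ‖f t‖ *
      ((fun x => ‖k x‖) ⋆[mul ℝ ℝ] fun x => ‖g x‖) (x - t) :=
    ((hk.norm.integrable_convolution (mul ℝ ℝ) hg.norm).comp_sub_left x).bdd_mul hf.norm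
      (ae_of_all _ fun t => by simpa using hM t)
  exact h

theorem convolution_mul_comm (f g : ℝ → ℂ) : (f ⋆[mul ℂ ℂ] g) = (g ⋆[mul ℂ ℂ] f) := by
  ext x
  rw [convolution_mul, convolution_mul_swap]
  simp_rw [mul_comm]

theorem aestronglyMeasurable_convolution_of_bounded (hf : AEStronglyMeasurable f)
    (hk : Integrable k) : AEStronglyMeasurable (f ⋆[mul ℂ ℂ] k) := by
  have h : AEStronglyMeasurable (fun p : ℝ × ℝ => mul ℂ ℂ (f p.2) (k (p.1 - p.2)))
      (volume.prod volume) := hf.convolution_integrand (mul ℂ ℂ) hk.1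
  exact h.integral_prod_right'

/-- Translation is continuous in `L¹(ℝ)`. -/
theorem continuous_integral_norm_sub_translate (hk : Integrable k) :
    Continuous fun u : ℝ => ∫ x, ‖k x - k (x - u)‖ := by
  have hm : MemLp k 1 := memLp_one_iff_integrable.2 hk
  have : Fact ((1 : ENNReal) ≠ ⊤) := ⟨ENNReal.one_ne_top⟩
  have hc : Continuous fun u : ℝ => DomAddAct.mk (-u) +ᵥ hm.toLp k :=
    (DomAddAct.continuous_mk.comp continuous_neg).vadd continuous_const
  have h1 : Continuous fun u : ℝ => ‖hm.toLp k - (DomAddAct.mk (-u) +ᵥ hm.toLp k)‖ :=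
    (continuous_const.sub hc).norm
  refine h1.congr fun u => ?_
  rw [DomAddAct.mk_vadd_toLp, ← MemLp.toLp_sub, L1.norm_eq_integral_norm]
  refine integral_congr_ae ?_
  filter_upwards [MemLp.coeFn_toLp (hm.sub (hm.comp_measurePreserving
    (measurePreserving_vadd (-u) (volume : Measure ℝ))))] with x hx
  refine (congrArg norm hx).trans ?_
  simp [sub_eq_neg_add]

end Convolution

/-! ### Convolution operators near a frequency -/

section LocalIdentity

open ContinuousLinearMap
open scoped Convolution FourierTransform

variable {k τ : ℝ → ℂ}

/-- The dilation `ε τ(ε x)` of `τ`, modulated by the character of frequency `u`. Its Fourier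
transform is that of `τ`, squeezed by the factor `ε` and centred at `u`. -/
noncomputable def modDilation (τ : ℝ → ℂ) (u ε : ℝ) (x : ℝ) : ℂ :=
  Complex.exp (2 * Real.pi * Complex.I * (u * x : ℝ)) * (ε * τ (ε * x))

theorem norm_exp_two_pi_I_mul (x : ℝ) :
    ‖Complex.exp (2 * Real.pi * Complex.I * (x : ℝ))‖ = 1 := by
  rw [show 2 * (Real.pi : ℂ) * Complex.I * (x : ℝ) = ((2 * Real.pi * x : ℝ) : ℂ) * Complex.I by
    push_cast; ring, Complex.norm_exp_ofReal_mul_I]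

theorem integrable_modDilation (hτ : Integrable τ) (u : ℝ) {ε : ℝ} (hε : 0 < ε) :
    Integrable (modDilation τ u ε) := by
  refine (((hτ.comp_mul_left' hε.ne').const_mul (ε : ℂ))).bdd_mul (c := 1) ?_
    (ae_of_all _ fun x => (norm_exp_two_pi_I_mul _).le)
  exact Continuous.aestronglyMeasurable (by fun_prop)

theorem modDilation_sub (τ : ℝ → ℂ) (u ε x y : ℝ) :
    Complex.exp (2 * Real.pi * Complex.I * (-(u * y) : ℝ)) * modDilation τ u ε x
      - modDilation τ u ε (x - y) =
    Complex.exp (2 * Real.pi * Complex.I * (u * (x - y) : ℝ)) *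
      (ε * (τ (ε * x) - τ (ε * x - ε * y))) := by
  have h : Complex.exp (2 * Real.pi * Complex.I * (u * (x - y) : ℝ)) =
      Complex.exp (2 * Real.pi * Complex.I * (-(u * y) : ℝ)) *
        Complex.exp (2 * Real.pi * Complex.I * (u * x : ℝ)) := by
    rw [← Complex.exp_add]; congr 1; push_cast; ring
  unfold modDilation
  rw [h, mul_sub ε x y]
  ring

/-- Near the frequency `u` the convolution operator with kernel `k` acts like multiplication by
the number `𝓕 k u`. -/
theorem tendsto_integral_norm_fourier_mul_sub_convolution (hk : Integrable k) (hτ : Integrable τ)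
    (u : ℝ) :
    Tendsto (fun ε : ℝ => ∫ x, ‖𝓕 k u * modDilation τ u ε x -
      (k ⋆[mul ℂ ℂ] modDilation τ u ε) x‖) (𝓝[>] 0) (𝓝 0) := by
  set ω : ℝ → ℝ := fun v => ∫ x, ‖τ x - τ (x - v)‖ with hω
  have hωc : Continuous ω := continuous_integral_norm_sub_translate hτ
  have hω0 : ω 0 = 0 := by simp [hω]
  have hωn : ∀ v, 0 ≤ ω v := fun v => integral_nonneg fun x => norm_nonneg _
  have hωb : ∀ v, ω v ≤ 2 * ∫ x, ‖τ x‖ := by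
    intro v
    have h1 : ∫ x, ‖τ (x - v)‖ = ∫ x, ‖τ x‖ := integral_sub_right_eq_self (fun x => ‖τ x‖) v
    calc ω v ≤ ∫ x, (‖τ x‖ + ‖τ (x - v)‖) :=
          integral_mono (hτ.sub (hτ.comp_sub_right v)).norm
            (hτ.norm.add (hτ.comp_sub_right v).norm) fun x => norm_sub_le _ _
      _ = 2 * ∫ x, ‖τ x‖ := by
          rw [integral_add hτ.norm (hτ.comp_sub_right v).norm, h1]; ring
  have hlim : Tendsto (fun ε : ℝ => ∫ y, ‖k y‖ * ω (ε * y)) (𝓝[>] 0) (𝓝 0) := by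
    have : Tendsto (fun ε : ℝ => ∫ y, ‖k y‖ * ω (ε * y)) (𝓝[>] 0) (𝓝 (∫ y : ℝ, (0 : ℝ))) := by
      refine tendsto_integral_filter_of_dominated_convergence
        (fun y => ‖k y‖ * (2 * ∫ x, ‖τ x‖)) (Eventually.of_forall fun ε => ?_)
        (Eventually.of_forall fun ε => ae_of_all _ fun y => ?_) (hk.norm.mul_const _)
        (ae_of_all _ fun y => ?_)
      · exact hk.1.norm.mul (Continuous.aestronglyMeasurable (by fun_prop))
      · rw [norm_mul, norm_norm, Real.norm_of_nonneg (hωn _)]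
        exact mul_le_mul_of_nonneg_left (hωb _) (norm_nonneg _)
      · have h2 : Tendsto (fun ε : ℝ => ‖k y‖ * ω (ε * y)) (𝓝 0) (𝓝 (‖k y‖ * ω (0 * y))) :=
          (Continuous.tendsto (by fun_prop) 0)
        rw [zero_mul, hω0, mul_zero] at h2
        exact h2.mono_left nhdsWithin_le_nhds
    simpa using this
  refine squeeze_zero' (Eventually.of_forall fun ε => integral_nonneg fun x => norm_nonneg _)
    ?_ hlim
  filter_upwards [self_mem_nhdsWithin] with ε hε
  rw [Set.mem_Ioi] at hε
  have hm := integrable_modDilation hτ u hε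
  set m := modDilation τ u ε with hm_def
  have hke : Integrable fun y => k y * Complex.exp (2 * Real.pi * Complex.I * (-(u * y) : ℝ)) := by
    refine hk.mul_bdd (c := 1) (Continuous.aestronglyMeasurable (by fun_prop))
      (ae_of_all _ fun x => (norm_exp_two_pi_I_mul _).le)
  have hF1 : Integrable (fun p : ℝ × ℝ =>
      (k p.2 * Complex.exp (2 * Real.pi * Complex.I * (-(u * p.2) : ℝ))) * m p.1)
      (volume.prod volume) := (hm.mul_prod hke).congr (ae_of_all _ fun p => mul_comm _ _)
  have hF2 : Integrable (fun p : ℝ × ℝ => k p.2 * m (p.1 - p.2)) (volume.prod volume) :=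
    hk.convolution_integrand (mul ℂ ℂ) hm
  have hF : Integrable (fun p : ℝ × ℝ => (k p.2 *
      (Complex.exp (2 * Real.pi * Complex.I * (-(u * p.2) : ℝ)) * m p.1 - m (p.1 - p.2))))
      (volume.prod volume) := by
    refine (hF1.sub hF2).congr (ae_of_all _ fun p => ?_)
    simp only [Pi.sub_apply]; ring
  have hfour : 𝓕 k u = ∫ y, k y * Complex.exp (2 * Real.pi * Complex.I * (-(u * y) : ℝ)) := by
    rw [Real.fourier_real_eq_integral_exp_smul]
    refine integral_congr_ae (ae_of_all _ fun y => ?_)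
    simp only [smul_eq_mul]
    rw [mul_comm]; congr 2; push_cast; ring
  calc ∫ x, ‖𝓕 k u * m x - (k ⋆[mul ℂ ℂ] m) x‖
      = ∫ x, ‖∫ y, k y * (Complex.exp (2 * Real.pi * Complex.I * (-(u * y) : ℝ)) * m x
          - m (x - y))‖ := by
        refine integral_congr_ae ?_
        filter_upwards [hk.ae_convolution_exists (mul ℂ ℂ) hm] with x hx
        have hx' : Integrable fun y => k y * m (x - y) := hx
        rw [hfour, convolution_mul, ← integral_mul_const, ← integral_sub (hke.mul_const _) hx']
        congr 1
        refine integral_congr_ae (ae_of_all _ fun y => ?_)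
        simp only; ring
    _ ≤ ∫ x, ∫ y, ‖k y * (Complex.exp (2 * Real.pi * Complex.I * (-(u * y) : ℝ)) * m x
          - m (x - y))‖ :=
        integral_mono hF.integral_prod_left.norm hF.norm.integral_prod_left
          fun x => norm_integral_le_integral_norm _
    _ = ∫ y, ∫ x, ‖k y * (Complex.exp (2 * Real.pi * Complex.I * (-(u * y) : ℝ)) * m x
          - m (x - y))‖ := integral_integral_swap hF.norm
    _ = ∫ y, ‖k y‖ * ω (ε * y) := by
        refine integral_congr_ae (ae_of_all _ fun y => ?_)
        simp only
        simp_rw [norm_mul, hm_def, modDilation_sub, norm_mul, norm_exp_two_pi_I_mul, one_mul]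
        rw [integral_const_mul, integral_const_mul]
        congr 1
        rw [Measure.integral_comp_mul_left (fun x => ‖τ x - τ (x - ε * y)‖) ε]
        simp only [Complex.norm_real, smul_eq_mul, Real.norm_of_nonneg hε.le]
        rw [abs_of_pos (inv_pos.2 hε), mul_inv_cancel_left₀ hε.ne']

end LocalIdentity

/-! ### Wiener's Tauberian theorem for band-limited kernels -/

section WienerTauberian

open ContinuousLinearMap
open scoped Convolution FourierTransform ContDiff

variable {f k χ θ : ℝ → ℂ} {M : ℝ}

theorem fourierInv_eq_integral_exp (g : ℝ → ℂ) (x : ℝ) :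
    𝓕⁻ g x = ∫ t, Complex.exp (2 * Real.pi * Complex.I * (t * x : ℝ)) * g t := by
  rw [Real.fourierInv_eq']
  refine integral_congr_ae (ae_of_all _ fun t => ?_)
  simp only [RCLike.inner_apply, conj_trivial, smul_eq_mul]
  congr 2; push_cast; ring

theorem fourierInv_comp_dilation (g : ℝ → ℂ) (u : ℝ) {ε : ℝ} (hε : 0 < ε) :
    𝓕⁻ (fun t => g ((t - u) / ε)) = modDilation (𝓕⁻ g) u ε := by
  ext x
  unfold modDilation
  rw [fourierInv_eq_integral_exp, fourierInv_eq_integral_exp]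
  have h1 := integral_sub_right_eq_self (μ := volume) (fun t : ℝ =>
    Complex.exp (2 * Real.pi * Complex.I * ((t + u) * x : ℝ)) * g (t / ε)) u
  have h2 := Measure.integral_comp_div (fun t : ℝ =>
    Complex.exp (2 * Real.pi * Complex.I * ((ε * t + u) * x : ℝ)) * g t) ε
  simp only [sub_add_cancel] at h1
  simp only [mul_div_cancel₀ _ hε.ne'] at h2
  rw [h1, h2, abs_of_pos hε, Complex.real_smul, ← integral_const_mul, ← integral_const_mul,
    ← integral_const_mul]
  refine integral_congr_ae (ae_of_all _ fun t => ?_)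
  simp only
  rw [show Complex.exp (2 * Real.pi * Complex.I * ((ε * t + u) * x : ℝ)) =
    Complex.exp (2 * Real.pi * Complex.I * (u * x : ℝ)) *
    Complex.exp (2 * Real.pi * Complex.I * (t * (ε * x) : ℝ)) by
      rw [← Complex.exp_add]; congr 1; push_cast; ring]
  ring

theorem integrable_fourierInv (hχ : ContDiff ℝ ∞ χ) (hc : HasCompactSupport χ) :
    Integrable (𝓕⁻ χ) := by
  have h := (𝓕⁻ (hc.toSchwartzMap hχ)).integrable (μ := volume)
  rwa [SchwartzMap.fourierInv_coe] at h

theorem fourierInv_convolution_fourierInv (hχ : ContDiff ℝ ∞ χ) (hc : HasCompactSupport χ)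
    (hθ : ContDiff ℝ ∞ θ) (hc' : HasCompactSupport θ) :
    (𝓕⁻ χ ⋆[mul ℂ ℂ] 𝓕⁻ θ) = 𝓕⁻ (fun t => χ t * θ t) := by
  have h : SchwartzMap.convolution (mul ℂ ℂ) (𝓕⁻ (hc.toSchwartzMap hχ))
      (𝓕⁻ (hc'.toSchwartzMap hθ)) =
      𝓕⁻ (SchwartzMap.pairing (mul ℂ ℂ) (hc.toSchwartzMap hχ) (hc'.toSchwartzMap hθ)) := by
    simp [SchwartzMap.convolution]
  ext x
  have h2 := SchwartzMap.convolution_apply (mul ℂ ℂ) (𝓕⁻ (hc.toSchwartzMap hχ))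
    (𝓕⁻ (hc'.toSchwartzMap hθ)) x
  rw [h, SchwartzMap.fourierInv_coe, SchwartzMap.fourierInv_coe, SchwartzMap.fourierInv_coe] at h2
  exact h2.symm

/-- A smooth compactly supported function equal to `1` on the unit ball. -/
theorem exists_contDiff_eq_one_on_ball :
    ∃ B : ℝ → ℂ, ContDiff ℝ ∞ B ∧ HasCompactSupport B ∧ ∀ t, |t| ≤ 1 → B t = 1 := by
  let b : ContDiffBump (0 : ℝ) := ⟨1, 2, one_pos, one_lt_two⟩
  refine ⟨fun t => (b t : ℂ), Complex.ofRealCLM.contDiff.comp b.contDiff,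
    b.hasCompactSupport.comp_left (g := fun x : ℝ => (x : ℂ)) rfl, fun t ht => ?_⟩
  have : b t = 1 := b.one_of_mem_closedBall (by simpa using ht)
  simp [this]

/-- If `F` is eventually at most half of any of its eventual bounds, up to an arbitrarily small
error, then it tends to zero. -/
theorem tendsto_zero_of_eventually_le_half {F : ℝ → ℂ} (hF : ∀ x, ‖F x‖ ≤ M)
    (h : ∀ L, (∀ᶠ x in atTop, ‖F x‖ ≤ L) → ∀ η > 0, ∀ᶠ x in atTop, ‖F x‖ ≤ L / 2 + η) :
    Tendsto F atTop (𝓝 0) := by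
  set A : Set ℝ := {L | ∀ᶠ x in atTop, ‖F x‖ ≤ L} with hA
  have hne : A.Nonempty := ⟨M, Eventually.of_forall hF⟩
  have hlow : ∀ L ∈ A, 0 ≤ L := fun L hL => by
    obtain ⟨x, hx⟩ := hL.exists
    exact (norm_nonneg _).trans hx
  have hbdd : BddBelow A := ⟨0, hlow⟩
  have hs0 : sInf A ≤ 0 := by
    by_contra! hs
    obtain ⟨L, hL, hLs⟩ := exists_lt_of_csInf_lt hne (show sInf A < sInf A + sInf A / 4 by linarith)
    have := csInf_le hbdd (show L / 2 + sInf A / 8 ∈ A from h L hL _ (by positivity))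
    linarith
  rw [NormedAddGroup.tendsto_nhds_zero]
  intro ε hε
  obtain ⟨L, hL, hLs⟩ := exists_lt_of_csInf_lt hne (hs0.trans_lt hε)
  exact Eventually.mono hL fun x hx => hx.trans_lt hLs

/-- The local step of Wiener's theorem: if `f ⋆ k` tends to zero and `𝓕 k` does not vanish at `u`,
then `f ⋆ h` tends to zero for every kernel `h` whose spectrum lies close enough to `u`. With a
kernel `m` whose transform is `1` on that spectrum, `F = f ⋆ h` satisfies
`𝓕 k u • F = F ⋆ (𝓕 k u • m - k ⋆ m) + o(1)`, and the kernel on the right has small `L¹` norm. -/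
theorem exists_tendsto_convolution_of_fourier_ne_zero (hf : AEStronglyMeasurable f)
    (hM : ∀ x, ‖f x‖ ≤ M) (hk : Integrable k) (hfk : Tendsto (f ⋆[mul ℂ ℂ] k) atTop (𝓝 0))
    {u : ℝ} (hu : 𝓕 k u ≠ 0) :
    ∃ ε > 0, ∀ χ : ℝ → ℂ, ContDiff ℝ ∞ χ → HasCompactSupport χ →
      tsupport χ ⊆ Metric.ball u ε → Tendsto (f ⋆[mul ℂ ℂ] 𝓕⁻ χ) atTop (𝓝 0) := by
  obtain ⟨B, hB, hBc, hB1⟩ := exists_contDiff_eq_one_on_ball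
  have hτ := integrable_fourierInv hB hBc
  have hc : 0 < ‖𝓕 k u‖ := norm_pos_iff.2 hu
  obtain ⟨ε, hεsmall, hε⟩ := (((tendsto_integral_norm_fourier_mul_sub_convolution hk hτ
    u).eventually (gt_mem_nhds (half_pos hc))).and self_mem_nhdsWithin).exists
  refine ⟨ε, hε, fun χ hχ hχc hsupp => ?_⟩
  set θ : ℝ → ℂ := fun t => B ((t - u) / ε) with hθ_def
  have hθ : ContDiff ℝ ∞ θ := hB.comp (by fun_prop)
  have hθc : HasCompactSupport θ := by
    have := hBc.comp_homeomorph ((Homeomorph.subRight u).trans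
      (Homeomorph.mulRight₀ ε⁻¹ (inv_ne_zero hε.ne')))
    simpa [hθ_def, div_eq_mul_inv, Function.comp_def] using this
  have hm := integrable_modDilation hτ u hε
  rw [← fourierInv_comp_dilation B u hε] at hεsmall hm
  have hh := integrable_fourierInv hχ hχc
  set h := 𝓕⁻ χ with h_def
  set m := 𝓕⁻ θ with m_def
  have hhm : (h ⋆[mul ℂ ℂ] m) = h := by
    rw [h_def, m_def, fourierInv_convolution_fourierInv hχ hχc hθ hθc]
    congr 1
    ext t
    by_cases ht : t ∈ tsupport χ
    · have h1 := hsupp ht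
      rw [Metric.mem_ball, Real.dist_eq] at h1
      have : θ t = 1 := hB1 _ (by rw [abs_div, abs_of_pos hε]; exact (div_le_one hε).2 h1.le)
      rw [this, mul_one]
    · rw [image_eq_zero_of_notMem_tsupport ht, zero_mul]
  set F := (f ⋆[mul ℂ ℂ] h) with hF_def
  have hFm : AEStronglyMeasurable F := aestronglyMeasurable_convolution_of_bounded hf hh
  have hFb : ∀ x, ‖F x‖ ≤ M * ∫ y, ‖h y‖ := norm_convolution_le hM hh
  have hFF : (F ⋆[mul ℂ ℂ] m) = F := by
    rw [hF_def, convolution_assoc_of_bounded hf hM hh hm, hhm]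
  have hkm : Integrable (k ⋆[mul ℂ ℂ] m) := hk.integrable_convolution _ hm
  have hFk : Tendsto (F ⋆[mul ℂ ℂ] (k ⋆[mul ℂ ℂ] m)) atTop (𝓝 0) := by
    have : (F ⋆[mul ℂ ℂ] (k ⋆[mul ℂ ℂ] m)) =
        ((f ⋆[mul ℂ ℂ] k) ⋆[mul ℂ ℂ] (h ⋆[mul ℂ ℂ] m)) := by
      rw [← convolution_assoc_of_bounded hFm hFb hk hm, hF_def,
        convolution_assoc_of_bounded hf hM hh hk, convolution_mul_comm h k,
        ← convolution_assoc_of_bounded hf hM hk hh,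
        convolution_assoc_of_bounded (aestronglyMeasurable_convolution_of_bounded hf hk)
          (norm_convolution_le hM hk) hh hm]
    rw [this]
    exact tendsto_convolution_zero (aestronglyMeasurable_convolution_of_bounded hf hk)
      (norm_convolution_le hM hk) hfk (hh.integrable_convolution _ hm)
  set g : ℝ → ℂ := fun x => 𝓕 k u * m x - (k ⋆[mul ℂ ℂ] m) x with hg_def
  have hg : Integrable g := (hm.const_mul _).sub hkm
  have hid : ∀ x, 𝓕 k u * F x = (F ⋆[mul ℂ ℂ] g) x + (F ⋆[mul ℂ ℂ] (k ⋆[mul ℂ ℂ] m)) x := by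
    intro x
    have e1 : Integrable fun t => F t * g (x - t) :=
      convolutionExistsAt_of_bounded hFm hFb hg x
    have e2 : Integrable fun t => F t * (k ⋆[mul ℂ ℂ] m) (x - t) :=
      convolutionExistsAt_of_bounded hFm hFb hkm x
    conv_lhs => rw [← hFF]
    rw [convolution_mul, convolution_mul, convolution_mul, ← integral_add e1 e2,
      ← integral_const_mul]
    refine integral_congr_ae (ae_of_all _ fun t => ?_)
    simp only [hg_def]
    ring
  refine tendsto_zero_of_eventually_le_half hFb fun L hL η hη => ?_
  have hL0 : 0 ≤ L := by
    obtain ⟨x, hx⟩ := hL.exists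
    exact (norm_nonneg _).trans hx
  have hη' : 0 < ‖𝓕 k u‖ * η / 2 := by positivity
  filter_upwards [eventually_norm_convolution_le hFm hFb hg hL hη',
    NormedAddGroup.tendsto_nhds_zero.1 hFk _ hη'] with x h1 h2
  have h3 : L * ∫ y, ‖g y‖ ≤ L * (‖𝓕 k u‖ / 2) := mul_le_mul_of_nonneg_left hεsmall.le hL0
  have h4 : ‖𝓕 k u‖ * ‖F x‖ ≤ ‖𝓕 k u‖ * (L / 2 + η) := by
    rw [← norm_mul, hid]
    refine (norm_add_le _ _).trans ?_
    linarith
  exact le_of_mul_le_mul_left h4 hc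

/-- The local statements patch together: a property of smooth compactly supported functions that
is additive and holds near every point holds for all of them. -/
theorem contDiff_hasCompactSupport_induction {P : (ℝ → ℂ) → Prop}
    (hzero : P 0)
    (hadd : ∀ χ θ : ℝ → ℂ, ContDiff ℝ ∞ χ → HasCompactSupport χ → ContDiff ℝ ∞ θ →
      HasCompactSupport θ → P χ → P θ → P (χ + θ))
    (hloc : ∀ u : ℝ, ∃ ε > 0, ∀ χ : ℝ → ℂ, ContDiff ℝ ∞ χ → HasCompactSupport χ →
      tsupport χ ⊆ Metric.ball u ε → P χ)
    (hχ : ContDiff ℝ ∞ χ) (hc : HasCompactSupport χ) : P χ := by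
  suffices ∃ V, IsOpen V ∧ tsupport χ ⊆ V ∧ ∀ χ : ℝ → ℂ, ContDiff ℝ ∞ χ →
      HasCompactSupport χ → tsupport χ ⊆ V → P χ by
    obtain ⟨V, -, hV, h⟩ := this
    exact h χ hχ hc hV
  have hcK : IsCompact (tsupport χ) := hc
  generalize tsupport χ = K at hcK
  clear hχ hc
  refine hcK.induction_on ?_ ?_ ?_ ?_
  · refine ⟨∅, isOpen_empty, subset_rfl, fun χ _ _ h => ?_⟩
    rw [tsupport_eq_empty_iff.1 (Set.subset_empty_iff.1 h)]
    exact hzero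
  · intro s t hst ht
    obtain ⟨V, hV, htV, h⟩ := ht
    exact ⟨V, hV, hst.trans htV, h⟩
  · intro s t h₁ h₂
    obtain ⟨V₁, hV₁, hsV₁, h₁⟩ := h₁
    obtain ⟨V₂, hV₂, hsV₂, h₂⟩ := h₂
    refine ⟨V₁ ∪ V₂, hV₁.union hV₂, Set.union_subset_union hsV₁ hsV₂, fun χ hχ hc hsupp => ?_⟩
    have hdisj : Disjoint V₁ᶜ (tsupport χ \ V₂) := by
      rw [Set.disjoint_left]
      intro t ht ht'
      exact (hsupp ht'.1).elim ht ht'.2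
    obtain ⟨ρ, hρ0, hρ1, -⟩ := exists_contMDiffMap_zero_one_nhds_of_isClosed
      (modelWithCornersSelf ℝ ℝ) (n := ⊤) hV₁.isClosed_compl
      ((isClosed_tsupport χ).sdiff hV₂) hdisj
    have hρ : ContDiff ℝ ∞ fun t => (ρ t : ℂ) :=
      Complex.ofRealCLM.contDiff.comp ρ.contMDiff.contDiff
    have hsplit : χ = (fun t => χ t * ρ t) + fun t => χ t * (1 - ρ t) := by
      ext t; simp only [Pi.add_apply]; ring
    rw [hsplit]
    have hc₁ : HasCompactSupport fun t => χ t * ρ t := hc.mul_right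
    have hc₂ : HasCompactSupport fun t => χ t * (1 - ρ t) :=
      HasCompactSupport.mul_right (f' := fun t => 1 - (ρ t : ℂ)) hc
    refine hadd _ _ (hχ.mul hρ) hc₁ (hχ.mul (contDiff_const.sub hρ)) hc₂
      (h₁ _ (hχ.mul hρ) hc₁ ?_) (h₂ _ (hχ.mul (contDiff_const.sub hρ)) hc₂ ?_)
    · intro t ht
      by_contra htV
      have h0 : ∀ᶠ s in 𝓝 t, ρ s = 0 := hρ0.filter_mono (nhds_le_nhdsSet htV)
      refine (notMem_tsupport_iff_eventuallyEq.2 ?_) ht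
      filter_upwards [h0] with s hs
      simp [hs]
    · intro t ht
      by_contra htV
      have htχ : t ∈ tsupport χ :=
        closure_mono (Function.support_mul_subset_left χ fun t => 1 - (ρ t : ℂ)) ht
      have h0 : ∀ᶠ s in 𝓝 t, ρ s = 1 :=
        hρ1.filter_mono (nhds_le_nhdsSet (show t ∈ tsupport χ \ V₂ from ⟨htχ, htV⟩))
      refine (notMem_tsupport_iff_eventuallyEq.2 ?_) ht
      filter_upwards [h0] with s hs
      simp [hs]
  · intro u _
    obtain ⟨ε, hε, h⟩ := hloc u
    exact ⟨Metric.ball u ε, mem_nhdsWithin_of_mem_nhds (Metric.ball_mem_nhds u hε),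
      Metric.ball u ε, Metric.isOpen_ball, subset_rfl, h⟩

/-- Wiener's Tauberian theorem for band-limited kernels: if `f` is bounded, `f ⋆ k j` tends to
zero for a family of integrable kernels whose Fourier transforms have no common zero, then
`f ⋆ h` tends to zero for every kernel `h` whose Fourier transform is a test function. -/
theorem tendsto_convolution_fourierInv {J : Type*} {k : J → ℝ → ℂ} (hf : AEStronglyMeasurable f)
    (hM : ∀ x, ‖f x‖ ≤ M) (hk : ∀ j, Integrable (k j))
    (hfk : ∀ j, Tendsto (f ⋆[mul ℂ ℂ] k j) atTop (𝓝 0)) (hne : ∀ u, ∃ j, 𝓕 (k j) u ≠ 0)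
    (hχ : ContDiff ℝ ∞ χ) (hc : HasCompactSupport χ) :
    Tendsto (f ⋆[mul ℂ ℂ] 𝓕⁻ χ) atTop (𝓝 0) := by
  refine contDiff_hasCompactSupport_induction
    (P := fun χ => Tendsto (f ⋆[mul ℂ ℂ] 𝓕⁻ χ) atTop (𝓝 0)) ?_ ?_ ?_ hχ hc
  · have h : 𝓕⁻ (0 : ℝ → ℂ) = 0 := by
      ext x
      rw [fourierInv_eq_integral_exp]
      simp
    rw [h, convolution_zero]
    exact tendsto_const_nhds
  · intro χ θ hχ hχc hθ hθc h1 h2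
    have h : 𝓕⁻ (χ + θ) = 𝓕⁻ χ + 𝓕⁻ θ := by
      have := FourierTransform.fourierInv_add (hχc.toSchwartzMap hχ) (hθc.toSchwartzMap hθ)
      ext x
      have h' := congrArg (fun F : SchwartzMap ℝ ℂ => F x) this
      simp only [add_apply, SchwartzMap.fourierInv_coe] at h'
      exact h'
    have hadd : (f ⋆[mul ℂ ℂ] 𝓕⁻ (χ + θ)) = (f ⋆[mul ℂ ℂ] 𝓕⁻ χ) + (f ⋆[mul ℂ ℂ] 𝓕⁻ θ) := by
      rw [h]
      exact ConvolutionExists.distrib_add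
        (convolutionExistsAt_of_bounded hf hM (integrable_fourierInv hχ hχc))
        (convolutionExistsAt_of_bounded hf hM (integrable_fourierInv hθ hθc))
    rw [hadd]
    have h12 := h1.add h2
    rw [add_zero] at h12
    exact h12
  · intro u
    obtain ⟨j, hj⟩ := hne u
    exact exists_tendsto_convolution_of_fourier_ne_zero hf hM (hk j) (hfk j) hj

end WienerTauberian

/-! ### Slowly decreasing functions -/

section SlowlyDecreasing

open ContinuousLinearMap
open scoped Convolution FourierTransform ContDiff

/-- A non-negative kernel of positive mass whose Fourier transform is a test function: the square
of the transform of an even bump function. -/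
theorem exists_nonneg_fourierInv :
    ∃ (χ : ℝ → ℂ) (κ : ℝ → ℝ), ContDiff ℝ ∞ χ ∧ HasCompactSupport χ ∧
      (∀ x, 𝓕⁻ χ x = κ x) ∧ (∀ x, 0 ≤ κ x) ∧ Integrable κ ∧ 0 < ∫ x, κ x := by
  let b : ContDiffBump (0 : ℝ) := ⟨1, 2, one_pos, one_lt_two⟩
  set B : ℝ → ℂ := fun t => (b t : ℂ) with hB_def
  have hB : ContDiff ℝ ∞ B := Complex.ofRealCLM.contDiff.comp b.contDiff
  have hBc : HasCompactSupport B := b.hasCompactSupport.comp_left (g := fun x : ℝ => (x : ℂ)) rfl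
  have hBi : Integrable B := hB.continuous.integrable_of_hasCompactSupport hBc
  have hχ : ContDiff ℝ ∞ (B ⋆[mul ℂ ℂ] B) := by
    have h : ContDiff ℝ ∞ (B ⋆[mul ℝ ℂ] B) :=
      HasCompactSupport.contDiff_convolution_right (mul ℝ ℂ) hBc hBi.locallyIntegrable hB
    exact h
  have hχc : HasCompactSupport (B ⋆[mul ℂ ℂ] B) := hBc.convolution _ hBc
  have hconj : ∀ x, (starRingEnd ℂ) (𝓕⁻ B x) = 𝓕⁻ B x := by
    intro x
    rw [fourierInv_eq_integral_exp, ← integral_conj, ← integral_neg_eq_self]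
    refine integral_congr_ae (ae_of_all _ fun t => ?_)
    simp only [map_mul, ← Complex.exp_conj, Complex.conj_ofReal, Complex.conj_I, hB_def,
      ContDiffBump.neg, map_ofNat]
    congr 2
    push_cast
    ring
  have hre : ∀ x, 𝓕⁻ B x = ((𝓕⁻ B x).re : ℂ) := fun x =>
    (Complex.conj_eq_iff_re.1 (hconj x)).symm
  have hsq : ∀ x, 𝓕⁻ (B ⋆[mul ℂ ℂ] B) x = (((𝓕⁻ B x).re ^ 2 : ℝ) : ℂ) := by
    intro x
    rw [Real.fourierInv_eq_fourier_neg, Real.fourier_mul_convolution_eq hBi hBi,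
      ← Real.fourierInv_eq_fourier_neg, Complex.ofReal_pow, ← hre, sq]
  have hint : Integrable fun x => (𝓕⁻ B x).re ^ 2 := by
    have h := (integrable_fourierInv hχ hχc).re
    refine h.congr (ae_of_all _ fun x => ?_)
    simp only [hsq]
    exact Complex.ofReal_re _
  have hcont : Continuous fun x => (𝓕⁻ B x).re ^ 2 := by
    have h : Continuous (𝓕⁻ B) := by
      have h := (𝓕⁻ (hBc.toSchwartzMap hB)).continuous
      rwa [SchwartzMap.fourierInv_coe] at h
    exact (Complex.continuous_re.comp h).pow 2
  refine ⟨B ⋆[mul ℂ ℂ] B, fun x => (𝓕⁻ B x).re ^ 2, hχ, hχc, hsq, fun x => sq_nonneg _, hint, ?_⟩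
  rw [integral_pos_iff_support_of_nonneg (fun x => sq_nonneg _) hint]
  refine hcont.isOpen_support.measure_pos _ ⟨0, ?_⟩
  have h0 : 𝓕⁻ B 0 = ((∫ t, b t : ℝ) : ℂ) := by
    rw [fourierInv_eq_integral_exp, ← integral_complex_ofReal]
    simp [hB_def]
  rw [Function.mem_support, h0, Complex.ofReal_re]
  exact pow_ne_zero _ b.integral_pos.ne'

variable {f κ : ℝ → ℝ} {M : ℝ}

/-- A bounded slowly decreasing function whose averages against all dilations of a non-negative
kernel tend to zero tends to zero itself: over a short interval to the right of `x` the function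
is at least `f x - ε`, over a short interval to the left at most `f x + ε`, and a strongly
concentrated kernel sees little else. -/
theorem tendsto_zero_of_tendsto_average (hf : AEStronglyMeasurable f) (hM : ∀ x, |f x| ≤ M)
    (hκ : Integrable κ) (hκ0 : ∀ x, 0 ≤ κ x) (hκ1 : 0 < ∫ x, κ x)
    (hslow : ∀ ε > 0, ∃ δ > 0, ∃ X, ∀ x h, X ≤ x → 0 ≤ h → h ≤ δ → f x - ε ≤ f (x + h))
    (havg : ∀ R > 0, Tendsto (fun x => ∫ y, f (x - y) * (R * κ (R * y))) atTop (𝓝 0)) :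
    Tendsto f atTop (𝓝 0) := by
  have hM0 : 0 ≤ M := (abs_nonneg _).trans (hM 0)
  set I := ∫ x, κ x with hI
  rw [NormedAddGroup.tendsto_nhds_zero]
  intro ε₀ hε₀
  set ε := ε₀ / 4 with hε_def
  have hε : 0 < ε := by positivity
  obtain ⟨δ, hδ, X, hX⟩ := hslow ε hε
  -- the mass of the dilated kernel outside `[-δ/2, δ/2]` is small for large `R`
  have htail : Tendsto (fun R : ℝ => ∫ z, Set.indicator {z : ℝ | R * (δ / 2) < |z|} κ z) atTop
      (𝓝 0) := by
    have : Tendsto (fun R : ℝ => ∫ z, Set.indicator {z : ℝ | R * (δ / 2) < |z|} κ z) atTop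
        (𝓝 (∫ z : ℝ, (0 : ℝ))) := by
      refine tendsto_integral_filter_of_dominated_convergence κ
        (Eventually.of_forall fun R => ?_) (Eventually.of_forall fun R => ae_of_all _ fun z => ?_)
        hκ (ae_of_all _ fun z => ?_)
      · exact hκ.1.indicator (measurableSet_lt (by fun_prop) (by fun_prop))
      · refine (norm_indicator_le_norm_self _ _).trans_eq ?_
        rw [Real.norm_of_nonneg (hκ0 z)]
      · refine tendsto_const_nhds.congr' ?_
        filter_upwards [eventually_ge_atTop (|z| / (δ / 2))] with R hR
        rw [Set.indicator_of_notMem]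
        simp only [Set.mem_ofPred_eq, not_lt]
        exact (div_le_iff₀ (by positivity)).1 hR
    simpa using this
  have hη : 0 < ε * I / (2 * M + ε) := by positivity
  obtain ⟨R, hRtail, hR⟩ := ((htail.eventually (gt_mem_nhds hη)).and
    (eventually_gt_atTop (0 : ℝ))).exists
  set κR : ℝ → ℝ := fun y => R * κ (R * y) with hκR_def
  have hκRi : Integrable κR := (hκ.comp_mul_left' hR.ne').const_mul R
  have hκR0 : ∀ y, 0 ≤ κR y := fun y => mul_nonneg hR.le (hκ0 _)
  have hκR1 : ∫ y, κR y = I := by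
    rw [hκR_def, integral_const_mul, Measure.integral_comp_mul_left, abs_of_pos (inv_pos.2 hR),
      smul_eq_mul, mul_inv_cancel_left₀ hR.ne']
  set T : ℝ → ℝ := Set.indicator {y | δ / 2 < |y|} κR with hT_def
  have hTi : Integrable T := hκRi.indicator (measurableSet_lt (by fun_prop) (by fun_prop))
  have hT1 : (2 * M + ε) * ∫ y, T y ≤ ε * I := by
    have h1 : ∀ y, T y = R * Set.indicator {z : ℝ | R * (δ / 2) < |z|} κ (R * y) := by
      intro y
      have : R * y ∈ {z : ℝ | R * (δ / 2) < |z|} ↔ y ∈ {y | δ / 2 < |y|} := by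
        simp only [Set.mem_ofPred_eq, abs_mul, abs_of_pos hR]
        exact mul_lt_mul_iff_right₀ hR
      by_cases hy : y ∈ {y | δ / 2 < |y|}
      · rw [hT_def, Set.indicator_of_mem hy, Set.indicator_of_mem (this.2 hy)]
      · rw [hT_def, Set.indicator_of_notMem hy, Set.indicator_of_notMem (mt this.1 hy), mul_zero]
    have h2 : ∫ y, T y = ∫ z, Set.indicator {z : ℝ | R * (δ / 2) < |z|} κ z := by
      simp_rw [h1]
      rw [integral_const_mul, Measure.integral_comp_mul_left, abs_of_pos (inv_pos.2 hR),
        smul_eq_mul, mul_inv_cancel_left₀ hR.ne']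
    rw [h2, mul_comm]
    exact ((lt_div_iff₀ (by positivity)).1 hRtail).le
  have hconv : ∀ x, Integrable fun y => f (x - y) * κR y := fun x =>
    hκRi.bdd_mul (hf.comp_quasiMeasurePreserving
      (quasiMeasurePreserving_sub_left_of_right_invariant volume x))
      (ae_of_all _ fun y => by simpa using hM (x - y))
  have hup : ∀ x, X ≤ x → (f x - ε) * I - ε * I ≤ ∫ y, f (x + δ / 2 - y) * κR y := by
    intro x hx
    have h1 : ∫ y, ((f x - ε) * κR y - (2 * M + ε) * T y) ≤ ∫ y, f (x + δ / 2 - y) * κR y := by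
      refine integral_mono ((hκRi.const_mul _).sub (hTi.const_mul _)) (hconv _) fun y => ?_
      simp only
      by_cases hy : y ∈ {y | δ / 2 < |y|}
      · rw [hT_def, Set.indicator_of_mem hy, ← sub_mul]
        refine mul_le_mul_of_nonneg_right ?_ (hκR0 y)
        linarith [(abs_le.1 (hM x)).2, (abs_le.1 (hM (x + δ / 2 - y))).1]
      · rw [hT_def, Set.indicator_of_notMem hy, mul_zero, sub_zero]
        simp only [Set.mem_ofPred_eq, not_lt] at hy
        obtain ⟨hy1, hy2⟩ := abs_le.1 hy
        refine mul_le_mul_of_nonneg_right ?_ (hκR0 y)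
        have := hX x (δ / 2 - y) hx (by linarith) (by linarith)
        rwa [← add_sub_assoc] at this
    rw [integral_sub (hκRi.const_mul _) (hTi.const_mul _), integral_const_mul (f x - ε) κR,
      integral_const_mul (2 * M + ε) T, hκR1] at h1
    linarith
  have hdown : ∀ x, X + δ ≤ x → ∫ y, f (x - δ / 2 - y) * κR y ≤ (f x + ε) * I + ε * I := by
    intro x hx
    have h1 : ∫ y, f (x - δ / 2 - y) * κR y ≤ ∫ y, ((f x + ε) * κR y + (2 * M + ε) * T y) := by
      refine integral_mono (hconv _) ((hκRi.const_mul _).add (hTi.const_mul _)) fun y => ?_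
      simp only
      by_cases hy : y ∈ {y | δ / 2 < |y|}
      · rw [hT_def, Set.indicator_of_mem hy, ← add_mul]
        refine mul_le_mul_of_nonneg_right ?_ (hκR0 y)
        linarith [(abs_le.1 (hM x)).1, (abs_le.1 (hM (x - δ / 2 - y))).2]
      · rw [hT_def, Set.indicator_of_notMem hy, mul_zero, add_zero]
        simp only [Set.mem_ofPred_eq, not_lt] at hy
        obtain ⟨hy1, hy2⟩ := abs_le.1 hy
        refine mul_le_mul_of_nonneg_right ?_ (hκR0 y)
        have := hX (x - δ / 2 - y) (δ / 2 + y) (by linarith) (by linarith) (by linarith)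
        rw [show x - δ / 2 - y + (δ / 2 + y) = x by ring] at this
        linarith
    rw [integral_add (hκRi.const_mul _) (hTi.const_mul _), integral_const_mul (f x + ε) κR,
      integral_const_mul (2 * M + ε) T, hκR1] at h1
    linarith
  have hsmall := NormedAddGroup.tendsto_nhds_zero.1 (havg R hR) (ε * I) (by positivity)
  have hs1 := (tendsto_atTop_add_const_right atTop (δ / 2) tendsto_id).eventually hsmall
  have hs2 := (tendsto_atTop_add_const_right atTop (-(δ / 2)) tendsto_id).eventually hsmall
  filter_upwards [hs1, hs2, eventually_ge_atTop X, eventually_ge_atTop (X + δ)] with x h1 h2 h3 h4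
  have h5 := hup x h3
  have h6 := hdown x h4
  simp only [id, ← sub_eq_add_neg, Real.norm_eq_abs] at h1 h2
  have h7 := (abs_lt.1 h1).2
  have h8 := (abs_lt.1 h2).1
  have h9 : f x * I < (3 * ε) * I := by linarith
  have h10 : (-(3 * ε)) * I < f x * I := by linarith
  rw [Real.norm_eq_abs, abs_lt]
  constructor
  · linarith [lt_of_mul_lt_mul_right h10 hκ1.le]
  · linarith [lt_of_mul_lt_mul_right h9 hκ1.le]

/-- Wiener's Tauberian theorem for slowly decreasing functions. -/
theorem tendsto_zero_of_tendsto_convolution {J : Type*} {k : J → ℝ → ℂ}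
    (hf : AEStronglyMeasurable f) (hM : ∀ x, |f x| ≤ M)
    (hslow : ∀ ε > 0, ∃ δ > 0, ∃ X, ∀ x h, X ≤ x → 0 ≤ h → h ≤ δ → f x - ε ≤ f (x + h))
    (hk : ∀ j, Integrable (k j)) (hne : ∀ u, ∃ j, 𝓕 (k j) u ≠ 0)
    (hfk : ∀ j, Tendsto ((fun x => (f x : ℂ)) ⋆[mul ℂ ℂ] k j) atTop (𝓝 0)) :
    Tendsto f atTop (𝓝 0) := by
  obtain ⟨χ, κ, hχ, hχc, hχκ, hκ0, hκ, hκ1⟩ := exists_nonneg_fourierInv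
  refine tendsto_zero_of_tendsto_average hf hM hκ hκ0 hκ1 hslow fun R hR => ?_
  have hfc : AEStronglyMeasurable fun x => (f x : ℂ) :=
    Complex.continuous_ofReal.comp_aestronglyMeasurable hf
  have hsupp : HasCompactSupport fun t => χ ((t - 0) / R) := by
    have := hχc.comp_homeomorph (Homeomorph.mulRight₀ R⁻¹ (inv_ne_zero hR.ne'))
    simpa [div_eq_mul_inv, Function.comp_def] using this
  have h := tendsto_convolution_fourierInv hfc (fun x => by simpa using hM x) hk hfk hne
    (χ := fun t => χ ((t - 0) / R)) (hχ.comp (by fun_prop)) hsupp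
  rw [fourierInv_comp_dilation χ 0 hR] at h
  have h' := (Complex.continuous_re.tendsto 0).comp h
  refine h'.congr fun x => ?_
  rw [Function.comp_apply, convolution_mul_swap, ← Complex.ofReal_re (∫ y, _),
    ← integral_complex_ofReal]
  congr 2
  ext y
  simp [modDilation, hχκ]

end SlowlyDecreasing

/-! ### The Wiener algebra and Fourier inversion -/

section WienerAlgebra

open ContinuousLinearMap
open scoped Convolution FourierTransform ContDiff

variable {φ ψ : ℝ → ℂ}

theorem continuous_fourier (hψ : Integrable ψ) : Continuous (𝓕 ψ) :=
  VectorFourier.fourierIntegral_continuous Real.continuous_fourierChar continuous_inner hψ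

/-- Fourier inversion in `L¹`: both sides have the same integral against test functions. -/
theorem fourierInv_fourier_ae_eq (hψ : Integrable ψ) (hψ' : Integrable (𝓕 ψ)) :
    𝓕⁻ (𝓕 ψ) =ᵐ[volume] ψ := by
  have hflip : ∀ {f g : ℝ → ℂ}, Integrable f → Integrable g →
      ∫ x, 𝓕 f x * g x = ∫ x, f x * 𝓕 g x := fun {f g} hf hg => by
    simpa using! VectorFourier.integral_fourierIntegral_smul_eq_flip (L := innerₗ ℝ)
      Real.continuous_fourierChar continuous_inner hf hg
  have hcont : Continuous (𝓕⁻ (𝓕 ψ)) := by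
    rw [Real.fourierInv_eq_fourier_comp_neg]
    exact continuous_fourier hψ'.comp_neg
  refine ae_eq_of_integral_contDiff_smul_eq hcont.locallyIntegrable hψ.locallyIntegrable
    fun g hg hgc => ?_
  set G : ℝ → ℂ := fun x => (g x : ℂ) with hG_def
  have hG : ContDiff ℝ ∞ G := Complex.ofRealCLM.contDiff.comp hg
  have hGc : HasCompactSupport G := hgc.comp_left (g := fun x : ℝ => (x : ℂ)) rfl
  have hGi : Integrable G := hG.continuous.integrable_of_hasCompactSupport hGc
  have hGinv : 𝓕 (𝓕⁻ G) = G :=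
    hG.continuous.fourier_fourierInv_eq hGi (by
      have h := (𝓕 (hGc.toSchwartzMap hG)).integrable (μ := volume)
      rwa [SchwartzMap.fourier_coe] at h)
  simp_rw [Complex.real_smul]
  calc ∫ x, G x * 𝓕⁻ (𝓕 ψ) x
      = ∫ x, 𝓕 (𝓕 ψ) x * G (-x) := by
        rw [← integral_neg_eq_self]
        refine integral_congr_ae (ae_of_all _ fun x => ?_)
        simp only [Real.fourierInv_eq_fourier_neg, neg_neg]
        ring
    _ = ∫ x, 𝓕 ψ x * 𝓕⁻ G x := by
        rw [hflip hψ' hGi.comp_neg, Real.fourierInv_eq_fourier_comp_neg]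
    _ = ∫ x, G x * ψ x := by
        rw [hflip hψ (integrable_fourierInv hG hGc), hGinv]
        simp_rw [mul_comm]

theorem fourierHat_eq_fourier (f : ℝ → ℂ) (t : ℝ) : fourierHat f t = 𝓕 f (t / (2 * Real.pi)) := by
  rw [Real.fourier_real_eq_integral_exp_smul]
  refine integral_congr_ae (ae_of_all _ fun x => ?_)
  have : -2 * Real.pi * x * (t / (2 * Real.pi)) = -(t * x) := by
    field_simp
  simp only [smul_eq_mul, this]
  congr 2
  push_cast; ring

theorem continuous_fourierHat {f : ℝ → ℂ} (hf : Integrable f) : Continuous (fourierHat f) := by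
  simp_rw [funext (fourierHat_eq_fourier f)]
  exact (continuous_fourier hf).comp (continuous_id.div_const _)

theorem norm_fourierHat_le (f : ℝ → ℂ) (t : ℝ) : ‖fourierHat f t‖ ≤ ∫ x, ‖f x‖ := by
  refine (norm_integral_le_integral_norm _).trans_eq ?_
  refine integral_congr_ae (ae_of_all _ fun x => ?_)
  simp only [norm_mul]
  rw [show -(Complex.I * t * x) = ((-(t * x) : ℝ) : ℂ) * Complex.I by push_cast; ring,
    Complex.norm_exp_ofReal_mul_I, one_mul]

/-- The Riemann–Lebesgue lemma. -/
theorem tendsto_fourierHat_atBot (f : ℝ → ℂ) : Tendsto (fourierHat f) atBot (𝓝 0) := by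
  simp_rw [funext (fourierHat_eq_fourier f)]
  have h := (Real.zero_at_infty_fourier f).mono_left atBot_le_cocompact
  exact h.comp (tendsto_id.atBot_div_const (by positivity))

namespace MemWienerAlgebraCompact

theorem continuous (hφ : MemWienerAlgebraCompact φ) : Continuous φ := by
  obtain ⟨⟨ψ, hψ, rfl⟩, -⟩ := hφ
  exact continuous_fourierHat hψ

theorem integrable (hφ : MemWienerAlgebraCompact φ) : Integrable φ :=
  hφ.continuous.integrable_of_hasCompactSupport hφ.2

/-- By inversion, the transform of `φ = fourierHat ψ` is `2π ψ(-·)` almost everywhere. -/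
theorem integrable_fourierHat (hφ : MemWienerAlgebraCompact φ) : Integrable (fourierHat φ) := by
  have hi := hφ.integrable
  obtain ⟨⟨ψ, hψ, h⟩, -⟩ := hφ
  have hπ : (2 * Real.pi) ≠ 0 := by positivity
  have hψ' : 𝓕 ψ = fun u => φ (2 * Real.pi * u) := by
    ext u
    rw [h, fourierHat_eq_fourier, mul_div_cancel_left₀ _ hπ]
  have hψi : Integrable (𝓕 ψ) := by
    rw [hψ']
    exact hi.comp_mul_left' hπ
  have h1 : Integrable (𝓕⁻ (𝓕 ψ)) := hψ.congr (fourierInv_fourier_ae_eq hψ hψi).symm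
  have h2 : fourierHat φ = fun x => (2 * Real.pi : ℝ) • 𝓕⁻ (𝓕 ψ) (-x) := by
    ext x
    rw [Real.fourierInv_eq_fourier_neg, neg_neg, Real.fourier_real_eq_integral_exp_smul, hψ']
    have h3 := Measure.integral_comp_mul_left
      (fun t : ℝ => Complex.exp (-(Complex.I * x * t)) * φ t) (2 * Real.pi)
    rw [abs_of_pos (by positivity)] at h3
    have h4 : ∀ v : ℝ, Complex.exp (((-2 * Real.pi * v * x : ℝ) : ℂ) * Complex.I) •
        φ (2 * Real.pi * v) = Complex.exp (-(Complex.I * x * (2 * Real.pi * v : ℝ))) *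
          φ (2 * Real.pi * v) := by
      intro v
      rw [smul_eq_mul]
      congr 2
      push_cast; ring
    simp_rw [h4]
    rw [h3, smul_inv_smul₀ hπ]
    rfl
  rw [h2]
  exact h1.comp_neg.smul (2 * Real.pi : ℝ)

theorem fourier_fourierHat_neg (hφ : MemWienerAlgebraCompact φ) (u : ℝ) :
    𝓕 (fun x => fourierHat φ (-x)) u = 2 * Real.pi * φ (2 * Real.pi * u) := by
  have hπ : (0 : ℝ) < 2 * Real.pi := by positivity
  have h1 : Integrable (𝓕 φ) := by
    have := hφ.integrable_fourierHat.comp_mul_left' hπ.ne'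
    simpa [fourierHat_eq_fourier, hπ.ne'] using this
  rw [← hφ.integrable.fourierInv_fourier_eq h1 hφ.continuous.continuousAt,
    fourierInv_eq_integral_exp, Real.fourier_real_eq_integral_exp_smul, ← integral_neg_eq_self]
  have h3 := Measure.integral_comp_div
    (fun t : ℝ => Complex.exp (2 * Real.pi * Complex.I * (t * (2 * Real.pi * u) : ℝ)) * 𝓕 φ t)
      (2 * Real.pi)
  rw [abs_of_pos hπ, Complex.real_smul] at h3
  push_cast at h3 ⊢
  rw [← h3]
  refine integral_congr_ae (ae_of_all _ fun x => ?_)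
  simp only [neg_neg, smul_eq_mul, fourierHat_eq_fourier]
  congr 2
  have : (Real.pi : ℂ) ≠ 0 := by exact_mod_cast Real.pi_ne_zero
  field_simp

end MemWienerAlgebraCompact

end WienerAlgebra

/-! ### The Laplace transform as an absolutely convergent integral -/

section LaplaceRepresentation

open ContinuousLinearMap Set
open scoped Convolution

variable {S : ℝ → ℝ} {a : ℝ} {φ : ℝ → ℂ}

/-- The error `e^{-x} S(x) - a` in the asymptotic relation `S(x) ~ a e^x`. -/
noncomputable def normalizedError (S : ℝ → ℝ) (a x : ℝ) : ℝ := S x / Real.exp x - a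

theorem normalizedError_add_mul_exp (S : ℝ → ℝ) (a x : ℝ) :
    (normalizedError S a x + a) * Real.exp x = S x := by
  rw [normalizedError, sub_add_cancel, div_mul_cancel₀ _ (Real.exp_pos x).ne']

theorem integrableOn_normalizedError (hS : LocallyIntegrableOn S (Ici 0)) (a X : ℝ) :
    IntegrableOn (normalizedError S a) (Ioc 0 X) := by
  have h1 : IntegrableOn S (Icc 0 X) :=
    hS.integrableOn_compact_subset Icc_subset_Ici_self isCompact_Icc
  have h2 : IntegrableOn (fun x => Real.exp (-x) * S x - a) (Icc 0 X) :=
    (h1.continuousOn_mul (Continuous.continuousOn (by fun_prop)) isCompact_Icc).sub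
      (integrableOn_const (by simp))
  refine (h2.mono_set Ioc_subset_Icc_self).congr_fun (fun x _ => ?_) measurableSet_Ioc
  simp only [normalizedError, Real.exp_neg, div_eq_inv_mul]

theorem aestronglyMeasurable_normalizedError (hS : LocallyIntegrableOn S (Ici 0)) (a : ℝ) :
    AEStronglyMeasurable (normalizedError S a) (volume.restrict (Ioi 0)) := by
  have h1 : AEStronglyMeasurable S (volume.restrict (Ioi 0)) :=
    hS.aestronglyMeasurable.mono_set Ioi_subset_Ici_self
  have h2 : AEStronglyMeasurable (fun x => Real.exp (-x) * S x - a) (volume.restrict (Ioi 0)) :=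
    ((Continuous.aestronglyMeasurable (by fun_prop)).mul h1).sub aestronglyMeasurable_const
  refine h2.congr (ae_of_all _ fun x => ?_)
  simp only [normalizedError, Real.exp_neg, div_eq_inv_mul]

theorem integrableOn_cexp_mul_normalizedError (hS : LocallyIntegrableOn S (Ici 0))
    (hint : ∀ η > 0, IntegrableOn (fun x => Real.exp (-(η * x)) * normalizedError S a x) (Ioi 0))
    {w : ℂ} (hw : 0 < w.re) :
    IntegrableOn (fun x : ℝ => Complex.exp (-(w * x)) * normalizedError S a x) (Ioi 0) := by
  refine (hint w.re hw).norm.mono' (((Continuous.aestronglyMeasurable (by fun_prop))).mul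
    (Complex.continuous_ofReal.comp_aestronglyMeasurable
      (aestronglyMeasurable_normalizedError hS a))) (ae_of_all _ fun x => ?_)
  simp [Complex.norm_exp]

/-- The absolutely convergent representation of the Laplace transform of `S`. -/
theorem tendsto_laplacePartial (hS : LocallyIntegrableOn S (Ici 0))
    (hint : ∀ η > 0, IntegrableOn (fun x => Real.exp (-(η * x)) * normalizedError S a x) (Ioi 0))
    {s : ℂ} (hs : 1 < s.re) :
    Tendsto (laplacePartial S s) atTop (𝓝 ((∫ x in Ioi (0 : ℝ),
      Complex.exp (-((s - 1) * x)) * normalizedError S a x) + a / (s - 1))) := by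
  have hw : 0 < (s - 1).re := by simpa using hs
  have h1 := integrableOn_cexp_mul_normalizedError hS hint hw
  have hneg : (-(s - 1)).re < 0 := by simpa using hs
  have h2 : IntegrableOn (fun x : ℝ => (a : ℂ) * Complex.exp (-(s - 1) * x)) (Ioi 0) :=
    (integrableOn_exp_mul_complex_Ioi hneg 0).const_mul _
  have heq : ∀ x : ℝ, Complex.exp (-((s - 1) * x)) * normalizedError S a x +
      a * Complex.exp (-(s - 1) * x) = Complex.exp (-(s * x)) * S x := by
    intro x
    rw [← normalizedError_add_mul_exp S a x]
    push_cast
    rw [show -(s - 1) * (x : ℂ) = -(s * x) + x by ring,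
      show -((s - 1) * (x : ℂ)) = -(s * x) + x by ring, Complex.exp_add]
    ring
  have h3 := intervalIntegral_tendsto_integral_Ioi 0 (h1.add h2) tendsto_id
  have h4 : ∫ x in Ioi (0 : ℝ), (a : ℂ) * Complex.exp (-(s - 1) * x) = a / (s - 1) := by
    rw [integral_const_mul, integral_exp_mul_complex_Ioi hneg, Complex.ofReal_zero, mul_zero,
      Complex.exp_zero, neg_div_neg_eq, mul_one_div]
  simp only [Pi.add_apply, heq, id] at h3
  have h5 : ∫ x in Ioi (0 : ℝ), Complex.exp (-(s * x)) * S x =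
      (∫ x in Ioi (0 : ℝ), Complex.exp (-((s - 1) * x)) * normalizedError S a x) +
        a / (s - 1) := by
    rw [← h4, ← integral_add h1 h2]
    simp only [heq]
  rw [← h5]
  exact h3

theorem laplaceTransform_sub_pole (hS : LocallyIntegrableOn S (Ici 0))
    (hint : ∀ η > 0, IntegrableOn (fun x => Real.exp (-(η * x)) * normalizedError S a x) (Ioi 0))
    {s : ℂ} (hs : 1 < s.re) :
    laplaceTransform S s - a / (s - 1) =
      ∫ x in Ioi (0 : ℝ), Complex.exp (-((s - 1) * x)) * normalizedError S a x := by
  rw [laplaceTransform, (tendsto_laplacePartial hS hint hs).limUnder_eq, add_sub_cancel_right]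

/-- Fubini's theorem turns the smoothed boundary values of the Laplace transform into averages of
the damped error. -/
theorem integral_laplace_mul_eq (hS : LocallyIntegrableOn S (Ici 0))
    (hint : ∀ η > 0, IntegrableOn (fun x => Real.exp (-(η * x)) * normalizedError S a x) (Ioi 0))
    (hφ : Integrable φ) {σ : ℝ} (hσ : 1 < σ) (h : ℝ) :
    ∫ t : ℝ, (laplaceTransform S (σ + t * Complex.I) - (a : ℂ) / (σ + t * Complex.I - 1)) *
        Complex.exp (Complex.I * h * t) * φ t =
      ∫ x in Ioi (0 : ℝ), ((Real.exp (-((σ - 1) * x)) * normalizedError S a x : ℝ) : ℂ) *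
        fourierHat φ (x - h) := by
  have hη : 0 < σ - 1 := sub_pos.2 hσ
  have hF : Integrable (fun p : ℝ × ℝ =>
      Complex.exp (-(Complex.I * ((p.2 - h : ℝ) : ℂ) * p.1)) * (φ p.1 *
        ((Real.exp (-((σ - 1) * p.2)) * normalizedError S a p.2 : ℝ) : ℂ)))
      (volume.prod (volume.restrict (Ioi 0))) := by
    refine (hφ.mul_prod (hint _ hη).ofReal).bdd_mul (c := 1)
      (Continuous.aestronglyMeasurable (by fun_prop)) (ae_of_all _ fun p => ?_)
    rw [show -(Complex.I * ((p.2 - h : ℝ) : ℂ) * p.1) =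
      ((-((p.2 - h) * p.1) : ℝ) : ℂ) * Complex.I by push_cast; ring,
      Complex.norm_exp_ofReal_mul_I]
  calc _ = ∫ t : ℝ, ∫ x in Ioi (0 : ℝ), Complex.exp (-(Complex.I * ((x - h : ℝ) : ℂ) * t)) *
        (φ t * ((Real.exp (-((σ - 1) * x)) * normalizedError S a x : ℝ) : ℂ)) := by
        refine integral_congr_ae (ae_of_all _ fun t => ?_)
        simp only
        rw [laplaceTransform_sub_pole hS hint (by simpa using hσ), ← integral_mul_const,
          ← integral_mul_const]
        refine integral_congr_ae (ae_of_all _ fun x => ?_)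
        simp only
        rw [Complex.ofReal_mul, Complex.ofReal_exp]
        have : Complex.exp (-((σ + t * Complex.I - 1) * x)) * Complex.exp (Complex.I * h * t) =
            Complex.exp (-(Complex.I * ((x - h : ℝ) : ℂ) * t)) *
              Complex.exp ((-((σ - 1) * x) : ℝ) : ℂ) := by
          rw [← Complex.exp_add, ← Complex.exp_add]
          congr 1
          push_cast; ring
        linear_combination (φ t * normalizedError S a x) * this
    _ = ∫ x in Ioi (0 : ℝ), ∫ t : ℝ, Complex.exp (-(Complex.I * ((x - h : ℝ) : ℂ) * t)) *
        (φ t * ((Real.exp (-((σ - 1) * x)) * normalizedError S a x : ℝ) : ℂ)) :=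
        integral_integral_swap hF
    _ = _ := by
        refine integral_congr_ae (ae_of_all _ fun x => ?_)
        simp only [← mul_assoc]
        rw [integral_mul_const, mul_comm]
        rfl

/-- Differentiation under the integral sign. -/
theorem analyticOnNhd_laplace_sub_pole (hS : LocallyIntegrableOn S (Ici 0))
    (hint : ∀ η > 0, IntegrableOn (fun x => Real.exp (-(η * x)) * normalizedError S a x) (Ioi 0)) :
    AnalyticOnNhd ℂ (fun s : ℂ => laplaceTransform S s - (a : ℂ) / (s - 1)) {s : ℂ | 1 < s.re} := by
  have hopen : IsOpen {s : ℂ | 1 < s.re} := isOpen_lt continuous_const Complex.continuous_re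
  refine DifferentiableOn.analyticOnNhd ?_ hopen
  refine DifferentiableOn.congr (f := fun s : ℂ => ∫ x in Ioi (0 : ℝ),
    Complex.exp (-((s - 1) * x)) * normalizedError S a x) ?_
    fun s hs => laplaceTransform_sub_pole hS hint hs
  intro s hs
  rw [Set.mem_ofPred_eq] at hs
  set η := (s.re - 1) / 4 with hη_def
  have hη : 0 < η := by rw [hη_def]; linarith
  have hmeas : ∀ w : ℂ, AEStronglyMeasurable
      (fun x : ℝ => Complex.exp (-((w - 1) * x)) * normalizedError S a x)
      (volume.restrict (Ioi 0)) := fun w =>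
    (Continuous.aestronglyMeasurable (by fun_prop)).mul
      (Complex.continuous_ofReal.comp_aestronglyMeasurable
        (aestronglyMeasurable_normalizedError hS a))
  have key := hasDerivAt_integral_of_dominated_loc_of_deriv_le
    (μ := volume.restrict (Ioi (0 : ℝ))) (𝕜 := ℂ)
    (F := fun (w : ℂ) (x : ℝ) => Complex.exp (-((w - 1) * x)) * normalizedError S a x)
    (F' := fun (w : ℂ) (x : ℝ) => (Complex.exp (-((w - 1) * x)) * -x) * normalizedError S a x)
    (x₀ := s) (s := Metric.ball s η)
    (bound := fun x => η⁻¹ * ‖Real.exp (-(η * x)) * normalizedError S a x‖)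
    (Metric.ball_mem_nhds s hη) (Eventually.of_forall hmeas)
    (integrableOn_cexp_mul_normalizedError hS hint (by simpa using hs))
    ?_ ?_ ((hint η hη).norm.const_mul _) ?_
  · exact key.2.differentiableAt.differentiableWithinAt
  · exact (Continuous.aestronglyMeasurable (by fun_prop)).mul
      (Complex.continuous_ofReal.comp_aestronglyMeasurable
        (aestronglyMeasurable_normalizedError hS a))
  · filter_upwards [ae_restrict_mem measurableSet_Ioi] with x hx w hw
    rw [Set.mem_Ioi] at hx
    have hre : s.re - η ≤ w.re := by
      have h1 := (Complex.abs_re_le_norm (w - s)).trans (mem_ball_iff_norm.1 hw).le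
      have h2 := (abs_le.1 h1).1
      rw [Complex.sub_re] at h2
      linarith
    have h3 : x * Real.exp (-(η * x)) ≤ η⁻¹ := by
      have h4 := Real.add_one_le_exp (η * x)
      rw [Real.exp_neg, ← div_eq_mul_inv, div_le_iff₀ (Real.exp_pos _), inv_mul_eq_div,
        le_div_iff₀ hη]
      linarith
    have h5 : Real.exp (-((w.re - 1) * x)) ≤ Real.exp (-(η * x)) * Real.exp (-(η * x)) := by
      rw [← Real.exp_add]
      refine Real.exp_le_exp.2 ?_
      nlinarith
    simp only [norm_mul, Complex.norm_exp, norm_neg, Complex.norm_real, Real.norm_eq_abs,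
      Real.abs_exp, abs_of_pos hx]
    have h6 : (-((w - 1) * x)).re = -((w.re - 1) * x) := by simp
    rw [h6, ← mul_assoc]
    refine mul_le_mul_of_nonneg_right ?_ (abs_nonneg _)
    calc Real.exp (-((w.re - 1) * x)) * x
        ≤ (Real.exp (-(η * x)) * Real.exp (-(η * x))) * x :=
          mul_le_mul_of_nonneg_right h5 hx.le
      _ = (x * Real.exp (-(η * x))) * Real.exp (-(η * x)) := by ring
      _ ≤ η⁻¹ * Real.exp (-(η * x)) := mul_le_mul_of_nonneg_right h3 (Real.exp_pos _).le
  · refine ae_of_all _ fun x w _ => ?_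
    have h1 : HasDerivAt (fun w : ℂ => -((w - 1) * x)) (-x) w := by
      have h2 := (((hasDerivAt_id w).sub_const 1).mul_const (x : ℂ)).neg
      rw [one_mul] at h2
      exact h2
    exact h1.cexp.mul_const _

end LaplaceRepresentation

/-! ### Boundary values for a bounded error -/

section BoundaryValues

open ContinuousLinearMap Set
open scoped Convolution

variable {S : ℝ → ℝ} {a X M : ℝ} {φ p : ℝ → ℂ}

theorem integrableOn_exp_mul_normalizedError (hS : LocallyIntegrableOn S (Ici 0)) (hX : 0 ≤ X)
    (hM : ∀ x, X < x → |normalizedError S a x| ≤ M) {η : ℝ} (hη : 0 < η) :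
    IntegrableOn (fun x => Real.exp (-(η * x)) * normalizedError S a x) (Ioi 0) := by
  rw [← Ioc_union_Ioi_eq_Ioi hX]
  refine IntegrableOn.union ?_ ?_
  · refine (integrableOn_normalizedError hS a X).bdd_mul (c := 1)
      (Continuous.aestronglyMeasurable (by fun_prop)) ?_
    filter_upwards [ae_restrict_mem measurableSet_Ioc] with x hx
    rw [Real.norm_eq_abs, Real.abs_exp, Real.exp_le_one_iff]
    nlinarith [hx.1]
  · have h := exp_neg_integrableOn_Ioi X hη
    simp only [neg_mul] at h
    refine h.mul_bdd (c := M) ((aestronglyMeasurable_normalizedError hS a).mono_set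
      (Ioi_subset_Ioi hX)) ?_
    filter_upwards [ae_restrict_mem measurableSet_Ioi] with x hx
    exact hM x hx

theorem integrableOn_normalizedError_mul (hS : LocallyIntegrableOn S (Ici 0)) (hX : 0 ≤ X)
    (hM : ∀ x, X < x → |normalizedError S a x| ≤ M) (hp : Integrable p) {C : ℝ}
    (hC : ∀ x, ‖p x‖ ≤ C) :
    IntegrableOn (fun x => (normalizedError S a x : ℂ) * p x) (Ioi 0) := by
  rw [← Ioc_union_Ioi_eq_Ioi hX]
  refine IntegrableOn.union ?_ ?_
  · exact (integrableOn_normalizedError hS a X).ofReal.mul_bdd (c := C) hp.1.restrict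
      (ae_of_all _ hC)
  · refine hp.restrict.bdd_mul (c := M) (Complex.continuous_ofReal.comp_aestronglyMeasurable
      ((aestronglyMeasurable_normalizedError hS a).mono_set (Ioi_subset_Ioi hX))) ?_
    filter_upwards [ae_restrict_mem measurableSet_Ioi] with x hx
    rw [Complex.norm_real]
    exact hM x hx

/-- When the error is bounded near infinity, the smoothed boundary values of the Laplace transform
exist and are averages of the error. -/
theorem tendsto_integral_laplace_mul (hS : LocallyIntegrableOn S (Ici 0)) (hX : 0 ≤ X)
    (hM : ∀ x, X < x → |normalizedError S a x| ≤ M) (hφ : MemWienerAlgebraCompact φ) (h : ℝ) :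
    Tendsto (fun σ : ℝ => ∫ t : ℝ,
        (laplaceTransform S (σ + t * Complex.I) - (a : ℂ) / (σ + t * Complex.I - 1)) *
          Complex.exp (Complex.I * h * t) * φ t) (𝓝[>] 1)
      (𝓝 (∫ x in Ioi (0 : ℝ), (normalizedError S a x : ℂ) * fourierHat φ (x - h))) := by
  have hi := integrableOn_normalizedError_mul hS hX hM (hφ.integrable_fourierHat.comp_sub_right h)
    (fun x => norm_fourierHat_le φ (x - h))
  have key : Tendsto (fun σ : ℝ => ∫ x in Ioi (0 : ℝ),
      ((Real.exp (-((σ - 1) * x)) * normalizedError S a x : ℝ) : ℂ) * fourierHat φ (x - h))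
      (𝓝[>] 1) (𝓝 (∫ x in Ioi (0 : ℝ), (normalizedError S a x : ℂ) * fourierHat φ (x - h))) := by
    refine tendsto_integral_filter_of_dominated_convergence _ (Eventually.of_forall fun σ => ?_)
      ?_ hi.norm (ae_of_all _ fun x => ?_)
    · have h1 : AEStronglyMeasurable (fun x : ℝ => ((Real.exp (-((σ - 1) * x)) : ℝ) : ℂ) *
          ((normalizedError S a x : ℂ) * fourierHat φ (x - h))) (volume.restrict (Ioi 0)) :=
        (Continuous.aestronglyMeasurable (by fun_prop)).mul hi.1
      refine h1.congr (ae_of_all _ fun x => ?_)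
      simp only; push_cast; ring
    · filter_upwards [self_mem_nhdsWithin] with σ hσ
      filter_upwards [ae_restrict_mem measurableSet_Ioi] with x hx
      rw [Complex.ofReal_mul, mul_assoc, norm_mul, Complex.norm_real, Real.norm_eq_abs,
        Real.abs_exp]
      refine mul_le_of_le_one_left (norm_nonneg _) (Real.exp_le_one_iff.2 ?_)
      have h1 : 0 < σ - 1 := sub_pos.2 hσ
      have h2 : 0 < x := hx
      nlinarith
    · have h1 : Continuous fun σ : ℝ =>
          ((Real.exp (-((σ - 1) * x)) * normalizedError S a x : ℝ) : ℂ) * fourierHat φ (x - h) := by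
        fun_prop
      have h2 := h1.tendsto 1
      simp only [sub_self, zero_mul, neg_zero, Real.exp_zero, one_mul] at h2
      exact h2.mono_left nhdsWithin_le_nhds
  refine key.congr' ?_
  filter_upwards [self_mem_nhdsWithin] with σ hσ
  exact (integral_laplace_mul_eq hS
    (fun η hη => integrableOn_exp_mul_normalizedError hS hX hM hη) hφ.integrable hσ h).symm

/-- The part of the error on a bounded interval does not affect the averages at infinity. -/
theorem tendsto_average_iff (hS : LocallyIntegrableOn S (Ici 0)) (hX : 0 ≤ X)
    (hM : ∀ x, X < x → |normalizedError S a x| ≤ M) (hφ : MemWienerAlgebraCompact φ) :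
    Tendsto (fun h => ∫ x in Ioi (0 : ℝ), (normalizedError S a x : ℂ) * fourierHat φ (x - h))
        atTop (𝓝 0) ↔
      Tendsto ((fun x => (((Ioi X).indicator (normalizedError S a) x : ℝ) : ℂ))
        ⋆[mul ℂ ℂ] fun x => fourierHat φ (-x)) atTop (𝓝 0) := by
  have hsplit : ∀ h, ∫ x in Ioi (0 : ℝ), (normalizedError S a x : ℂ) * fourierHat φ (x - h) =
      (∫ x in Ioc 0 X, (normalizedError S a x : ℂ) * fourierHat φ (x - h)) +
      ((fun x => (((Ioi X).indicator (normalizedError S a) x : ℝ) : ℂ))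
        ⋆[mul ℂ ℂ] fun x => fourierHat φ (-x)) h := by
    intro h
    have hi := integrableOn_normalizedError_mul hS hX hM
      (hφ.integrable_fourierHat.comp_sub_right h) (fun x => norm_fourierHat_le φ (x - h))
    rw [← Ioc_union_Ioi_eq_Ioi hX] at hi ⊢
    rw [setIntegral_union (Ioc_disjoint_Ioi le_rfl) measurableSet_Ioi hi.left_of_union
      hi.right_of_union, convolution_mul, ← integral_indicator (measurableSet_Ioi (a := X))]
    congr 2
    ext x
    by_cases hx : x ∈ Ioi X
    · simp [hx]
    · simp [hx]
  have hzero : Tendsto (fun h => ∫ x in Ioc 0 X, (normalizedError S a x : ℂ) *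
      fourierHat φ (x - h)) atTop (𝓝 0) := by
    have h0 : Tendsto (fun h => ∫ x in Ioc 0 X, (normalizedError S a x : ℂ) *
        fourierHat φ (x - h)) atTop (𝓝 (∫ x in Ioc 0 X, (0 : ℂ))) := by
      have hD := (integrableOn_normalizedError hS a X).ofReal (𝕜 := ℂ)
      refine tendsto_integral_filter_of_dominated_convergence
        (fun x => ‖(normalizedError S a x : ℂ)‖ * ∫ t, ‖φ t‖)
        (Eventually.of_forall fun h => ?_) (Eventually.of_forall fun h => ae_of_all _ fun x => ?_)
        (hD.norm.mul_const _) (ae_of_all _ fun x => ?_)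
      · exact hD.1.mul (Continuous.aestronglyMeasurable
          ((continuous_fourierHat hφ.integrable).comp (by fun_prop)))
      · rw [norm_mul]
        exact mul_le_mul_of_nonneg_left (norm_fourierHat_le φ _) (norm_nonneg _)
      · have h1 : Tendsto (fun h : ℝ => x - h) atTop atBot :=
          (tendsto_atBot_add_const_left atTop x tendsto_neg_atTop_atBot).congr fun h => by ring
        simpa using ((tendsto_fourierHat_atBot φ).comp h1).const_mul (normalizedError S a x : ℂ)
    simpa using h0
  simp_rw [hsplit]
  constructor
  · intro h
    have h1 := h.sub hzero
    simpa using h1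
  · intro h
    have h1 := hzero.add h
    simpa using h1

theorem aestronglyMeasurable_indicator_normalizedError (hS : LocallyIntegrableOn S (Ici 0)) (a : ℝ)
    (hX : 0 ≤ X) : AEStronglyMeasurable ((Ioi X).indicator (normalizedError S a)) :=
  (aestronglyMeasurable_indicator_iff measurableSet_Ioi).2
    ((aestronglyMeasurable_normalizedError hS a).mono_set (Ioi_subset_Ioi hX))

theorem abs_indicator_normalizedError_le (hM0 : 0 ≤ M)
    (hM : ∀ x, X < x → |normalizedError S a x| ≤ M) (x : ℝ) :
    |(Ioi X).indicator (normalizedError S a) x| ≤ M := by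
  by_cases hx : x ∈ Ioi X
  · rw [indicator_of_mem hx]
    exact hM x hx
  · rw [indicator_of_notMem hx, abs_zero]
    exact hM0

/-- An asymptotic relation implies the boundary behaviour of the Laplace transform. -/
theorem pseudofunctionBoundaryBehavior_of_tendsto (hS : LocallyIntegrableOn S (Ici 0))
    (hX : 0 ≤ X) (hM : ∀ x, X < x → |normalizedError S a x| ≤ M)
    (hlim : Tendsto (normalizedError S a) atTop (𝓝 0)) (hφ : MemWienerAlgebraCompact φ) :
    PseudofunctionBoundaryBehaviorWrt
      (fun s : ℂ => laplaceTransform S s - (a : ℂ) / (s - 1)) 1 φ := by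
  refine ⟨analyticOnNhd_laplace_sub_pole hS
    fun η hη => integrableOn_exp_mul_normalizedError hS hX hM hη, 1, one_pos, _,
    fun h _ => tendsto_integral_laplace_mul hS hX hM hφ h, ?_⟩
  rw [tendsto_average_iff hS hX hM hφ]
  have hM0 : 0 ≤ M := (abs_nonneg _).trans (hM (X + 1) (lt_add_one X))
  refine tendsto_convolution_zero (M := M) (Complex.continuous_ofReal.comp_aestronglyMeasurable
    (aestronglyMeasurable_indicator_normalizedError hS a hX)) (fun x => ?_) ?_
    hφ.integrable_fourierHat.comp_neg
  · rw [Complex.norm_real]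
    exact abs_indicator_normalizedError_le hM0 hM x
  · have h1 : Tendsto ((Ioi X).indicator (normalizedError S a)) atTop (𝓝 0) := by
      refine hlim.congr' ?_
      filter_upwards [eventually_gt_atTop X] with x hx
      rw [indicator_of_mem (show x ∈ Ioi X from hx)]
    have h2 := (Complex.continuous_ofReal.tendsto 0).comp h1
    rw [Complex.ofReal_zero] at h2
    exact h2

theorem logLinearlySlowlyDecreasing_of_tendsto
    (hlim : Tendsto (normalizedError S a) atTop (𝓝 0)) : LogLinearlySlowlyDecreasing S := by
  intro ε hε
  obtain ⟨x₀, hx₀⟩ := eventually_atTop.1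
    (NormedAddGroup.tendsto_nhds_zero.1 hlim (ε / 8) (by positivity))
  refine ⟨min 1 (ε / (6 * (|a| + 1))), by positivity, x₀, fun x h hx h0 hh => ?_⟩
  have hh1 : h ≤ 1 := hh.trans (min_le_left _ _)
  have hh2 : h * (6 * (|a| + 1)) ≤ ε :=
    (le_div_iff₀ (by positivity)).1 (hh.trans (min_le_right _ _))
  have e1 : Real.exp h ≤ 3 := by
    have := Real.exp_le_exp.2 hh1
    linarith [Real.exp_one_lt_d9]
  have e2 : Real.exp h - 1 ≤ 3 * h := by
    have h1 := Real.add_one_le_exp (-h)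
    have h2 : Real.exp h * Real.exp (-h) = 1 := by rw [← Real.exp_add]; simp
    nlinarith [Real.exp_pos h]
  have e3 : 0 ≤ Real.exp h - 1 := by linarith [Real.add_one_le_exp h]
  have d1 := (abs_lt.1 (hx₀ x hx)).2
  have d2 := (abs_lt.1 (hx₀ (x + h) (by linarith))).1
  have key : (S (x + h) - S x) / Real.exp x =
      Real.exp h * normalizedError S a (x + h) - normalizedError S a x + (Real.exp h - 1) * a := by
    rw [div_eq_iff (Real.exp_pos x).ne', ← normalizedError_add_mul_exp S a (x + h),
      ← normalizedError_add_mul_exp S a x, Real.exp_add]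
    ring
  rw [key]
  have k1 : -(3 * (ε / 8)) ≤ Real.exp h * normalizedError S a (x + h) := by
    nlinarith [Real.exp_pos h]
  have k2 : -(ε / 2) ≤ (Real.exp h - 1) * a := by
    have : (Real.exp h - 1) * |a| ≤ 3 * h * |a| := mul_le_mul_of_nonneg_right e2 (abs_nonneg a)
    nlinarith [neg_abs_le a, abs_nonneg a]
  linarith

end BoundaryValues

/-! ### Lower bounds from slow decrease -/

section Boundedness

open Set

variable {S : ℝ → ℝ} {a x₀ C : ℝ} {φ : ℝ → ℂ}

/-- Iterating the slow decrease over steps of a fixed length: the one-step losses `e^{x + kδ}` sum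
to a geometric series, so that over an arbitrary step `S` loses at most a multiple of the current
value of the exponential. -/
theorem LogLinearlySlowlyDecreasing.exists_sub_ge (hslow : LogLinearlySlowlyDecreasing S) :
    ∃ C ≥ 0, ∃ x₀ ≥ 0, ∀ x h, x₀ ≤ x → 0 ≤ h → -(C * Real.exp (x + h)) ≤ S (x + h) - S x := by
  obtain ⟨δ, hδ, x₀, hx₀⟩ := hslow 1 one_pos
  have hone : ∀ x h, x₀ ≤ x → 0 ≤ h → h ≤ δ → -Real.exp x ≤ S (x + h) - S x := by
    intro x h hx h0 hh
    have h1 := hx₀ x h hx h0 hh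
    rw [le_div_iff₀ (Real.exp_pos x)] at h1
    linarith
  have hδ' : 0 < Real.exp δ - 1 := by linarith [Real.add_one_le_exp δ]
  set C := 1 + 1 / (Real.exp δ - 1) with hC
  have hC1 : 1 ≤ C := by rw [hC]; linarith [div_pos one_pos hδ']
  -- `C` is chosen so that the bound reproduces itself after one more step
  have hCδ : 1 + C ≤ C * Real.exp δ := by
    have h1 : C * (Real.exp δ - 1) = Real.exp δ := by
      rw [hC]; field_simp; ring
    linarith [Real.add_one_le_exp δ]
  have key : ∀ n : ℕ, ∀ x h, x₀ ≤ x → 0 ≤ h → h ≤ n * δ →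
      -(C * Real.exp (x + h)) ≤ S (x + h) - S x := by
    intro n
    induction n with
    | zero =>
      intro x h _ h0 hh
      rw [Nat.cast_zero, zero_mul] at hh
      obtain rfl : h = 0 := le_antisymm hh h0
      rw [add_zero, sub_self]
      have := Real.exp_pos x
      nlinarith
    | succ n ih =>
      intro x h hx h0 hh
      by_cases hcase : h ≤ δ
      · have h1 := hone x h hx h0 hcase
        have h2 : Real.exp x ≤ Real.exp (x + h) := Real.exp_le_exp.2 (by linarith)
        nlinarith [Real.exp_pos (x + h)]
      · push Not at hcase
        have hn : h - δ ≤ n * δ := by push_cast at hh; linarith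
        have h1 := ih x (h - δ) hx (by linarith) hn
        have h2 := hone (x + (h - δ)) δ (by linarith) hδ.le le_rfl
        rw [show x + (h - δ) + δ = x + h by ring] at h2
        have h3 : Real.exp (x + h) = Real.exp (x + (h - δ)) * Real.exp δ := by
          rw [← Real.exp_add]; congr 1; ring
        have h4 : (1 + C) * Real.exp (x + (h - δ)) ≤ C * Real.exp (x + h) := by
          rw [h3]
          nlinarith [Real.exp_pos (x + (h - δ))]
        linarith
  refine ⟨C, by linarith, max x₀ 0, le_max_right _ _, fun x h hx h0 => ?_⟩
  obtain ⟨n, hn⟩ := exists_nat_ge (h / δ)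
  exact key n x h ((le_max_left _ _).trans hx) h0 ((div_le_iff₀ hδ).1 hn)

/-- For a slowly decreasing `S` the normalized error is bounded below, and over a step `h` the
quotient `e^{-x} S(x)` loses at most the factor `e^{-h}` and an additive constant. -/
theorem LogLinearlySlowlyDecreasing.exists_normalizedError_ge
    (hslow : LogLinearlySlowlyDecreasing S) (a : ℝ) :
    ∃ C ≥ 0, ∃ x₀ ≥ 0, (∀ x, x₀ ≤ x → -C ≤ normalizedError S a x) ∧
      ∀ x h, x₀ ≤ x → 0 ≤ h →
        Real.exp (-h) * (normalizedError S a x + a) - C ≤ normalizedError S a (x + h) := by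
  obtain ⟨C, hC, x₀, hx₀, hS⟩ := hslow.exists_sub_ge
  have hgrow : ∀ x h, x₀ ≤ x → 0 ≤ h →
      Real.exp (-h) * (normalizedError S a x + a) - (C + |a|) ≤ normalizedError S a (x + h) := by
    intro x h hx h0
    have h1 := hS x h hx h0
    rw [← normalizedError_add_mul_exp S a (x + h), ← normalizedError_add_mul_exp S a x] at h1
    have h2 : Real.exp x = Real.exp (-h) * Real.exp (x + h) := by
      rw [← Real.exp_add]; congr 1; ring
    rw [h2] at h1
    have h3 : (Real.exp (-h) * (normalizedError S a x + a) - C) * Real.exp (x + h) ≤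
        (normalizedError S a (x + h) + a) * Real.exp (x + h) := by linarith
    have h4 := le_of_mul_le_mul_right h3 (Real.exp_pos _)
    linarith [le_abs_self a]
  set V := |normalizedError S a x₀ + a| with hV
  have hV0 : 0 ≤ V := abs_nonneg _
  refine ⟨V + (C + |a|), by positivity, x₀, hx₀, fun x hx => ?_, fun x h hx h0 => ?_⟩
  · have h1 := hgrow x₀ (x - x₀) le_rfl (sub_nonneg.2 hx)
    rw [add_sub_cancel] at h1
    have h2 : Real.exp (-(x - x₀)) ≤ 1 := Real.exp_le_one_iff.2 (by linarith)
    have h3 : -V ≤ Real.exp (-(x - x₀)) * (normalizedError S a x₀ + a) := by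
      have h4 : Real.exp (-(x - x₀)) * V ≤ V := mul_le_of_le_one_left hV0 h2
      have h5 := mul_le_mul_of_nonneg_left (neg_abs_le (normalizedError S a x₀ + a))
        (Real.exp_pos (-(x - x₀))).le
      rw [← hV] at h5
      linarith
    linarith
  · have := hgrow x h hx h0
    linarith

/-- For functions bounded below the convergence of the Laplace integrals is absolute. -/
theorem integrableOn_exp_mul_of_laplaceConverges (hS : LocallyIntegrableOn S (Ici 0))
    (hx₀ : 0 ≤ x₀) (hlow : ∀ x, x₀ ≤ x → -C ≤ normalizedError S a x)
    (hconv : ∀ s : ℂ, 1 < s.re → LaplaceConverges S s) {η : ℝ} (hη : 0 < η) :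
    IntegrableOn (fun x => Real.exp (-(η * x)) * normalizedError S a x) (Ioi 0) := by
  set f : ℝ → ℝ := fun x => Real.exp (-(η * x)) * (normalizedError S a x + C) with hf
  have hexp : IntegrableOn (fun x => Real.exp (-(η * x))) (Ioi 0) := by
    have h := exp_neg_integrableOn_Ioi 0 hη
    simpa only [neg_mul] using h
  have hloc : ∀ R, IntegrableOn f (Ioc 0 R) := fun R => by
    have h1 : IntegrableOn (fun x => normalizedError S a x + C) (Ioc 0 R) :=
      (integrableOn_normalizedError hS a R).add (integrableOn_const (by simp))
    refine h1.bdd_mul (c := 1) (Continuous.aestronglyMeasurable (by fun_prop)) ?_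
    filter_upwards [ae_restrict_mem measurableSet_Ioc] with x hx
    rw [Real.norm_eq_abs, Real.abs_exp, Real.exp_le_one_iff]
    nlinarith [hx.1]
  obtain ⟨L, hL⟩ := hconv (1 + η : ℝ) (by simpa using hη)
  have hre := (Complex.continuous_re.tendsto L).comp hL
  have hE := intervalIntegral_tendsto_integral_Ioi 0 (hexp.const_mul (C - a)) tendsto_id
  have hsum : ∀ᶠ R in atTop, (Complex.re ∘ laplacePartial S (1 + η : ℝ)) R +
      (∫ x in (0 : ℝ)..id R, (C - a) * Real.exp (-(η * x))) - (∫ x in Ioc 0 x₀, f x) =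
      ∫ x in x₀..R, ‖f x‖ := by
    filter_upwards [eventually_ge_atTop x₀] with R hR
    have hR0 : 0 ≤ R := hx₀.trans hR
    have hSR : IntervalIntegrable (fun x => Real.exp (-((1 + η) * x)) * S x) volume 0 R := by
      rw [intervalIntegrable_iff_integrableOn_Ioc_of_le hR0]
      refine IntegrableOn.mono_set ?_ Ioc_subset_Icc_self
      exact (hS.integrableOn_compact_subset Icc_subset_Ici_self
        isCompact_Icc).continuousOn_mul (Continuous.continuousOn (by fun_prop)) isCompact_Icc
    have h1 : (Complex.re ∘ laplacePartial S (1 + η : ℝ)) R =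
        ∫ x in (0 : ℝ)..R, Real.exp (-((1 + η) * x)) * S x := by
      rw [Function.comp_apply, laplacePartial, ← Complex.ofReal_re (∫ x in (0 : ℝ)..R, _),
        ← intervalIntegral.integral_ofReal]
      congr 2
      ext x
      push_cast
      rfl
    have h2 : IntervalIntegrable (fun x => (C - a) * Real.exp (-(η * x))) volume 0 R :=
      Continuous.intervalIntegrable (by fun_prop) _ _
    have h3 : ∫ x in (0 : ℝ)..R, f x =
        (∫ x in (0 : ℝ)..R, Real.exp (-((1 + η) * x)) * S x) +
          ∫ x in (0 : ℝ)..R, (C - a) * Real.exp (-(η * x)) := by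
      rw [← intervalIntegral.integral_add hSR h2]
      congr 1
      ext x
      rw [← normalizedError_add_mul_exp S a x, hf,
        show -((1 + η) * x) = -(η * x) + -x by ring, Real.exp_add]
      have : Real.exp (-x) * Real.exp x = 1 := by rw [← Real.exp_add]; simp
      linear_combination -(Real.exp (-(η * x)) * (normalizedError S a x + a)) * this
    have h4 : IntervalIntegrable f volume 0 x₀ :=
      (intervalIntegrable_iff_integrableOn_Ioc_of_le hx₀).2 (hloc x₀)
    have h5 : IntervalIntegrable f volume 0 R :=
      (intervalIntegrable_iff_integrableOn_Ioc_of_le hR0).2 (hloc R)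
    rw [h1, id, ← h3, ← intervalIntegral.integral_of_le hx₀,
      intervalIntegral.integral_interval_sub_left h5 h4]
    refine intervalIntegral.integral_congr fun x hx => ?_
    rw [uIcc_of_le hR] at hx
    have := hlow x hx.1
    exact (Real.norm_of_nonneg (mul_nonneg (Real.exp_pos _).le (by linarith))).symm
  have hlim := ((hre.add hE).sub_const (∫ x in Ioc 0 x₀, f x)).congr' hsum
  have hfi : IntegrableOn f (Ioi x₀) :=
    integrableOn_Ioi_of_intervalIntegral_norm_tendsto _ x₀
      (fun R => (hloc R).mono_set (Ioc_subset_Ioc_left hx₀)) tendsto_id hlim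
  have hf0 : IntegrableOn f (Ioi 0) := by
    rw [← Ioc_union_Ioi_eq_Ioi hx₀]
    exact (hloc x₀).union hfi
  refine (hf0.sub (hexp.mul_const C)).congr (ae_of_all _ fun x => ?_)
  simp only [Pi.sub_apply, hf]
  ring

end Boundedness

/-! ### Upper bound and conclusion -/

section UpperBound

open Set

variable {S : ℝ → ℝ} {a x₀ C : ℝ} {φ : ℝ → ℂ}

/-- A non-negative Fourier transform of a non-zero function is bounded below by a positive
constant on some interval. -/
theorem MemWienerAlgebraCompact.exists_fourierHat_ge (hφ : MemWienerAlgebraCompact φ)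
    (h0 : φ 0 ≠ 0) (hpos : ∀ x, 0 ≤ (fourierHat φ x).re ∧ (fourierHat φ x).im = 0) :
    ∃ c > 0, ∃ u, ∃ l > 0, ∀ y, u ≤ y → y ≤ u + l → c ≤ (fourierHat φ y).re := by
  have hne : ∃ z, fourierHat φ z ≠ 0 := by
    by_contra! h
    have h1 := hφ.fourier_fourierHat_neg 0
    simp only [h, mul_zero] at h1
    rw [Real.fourier_real_eq_integral_exp_smul] at h1
    simp [h0, Real.pi_ne_zero] at h1
  obtain ⟨z, hz⟩ := hne
  have hz0 : 0 < (fourierHat φ z).re := by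
    refine lt_of_le_of_ne (hpos z).1 fun h => hz ?_
    exact Complex.ext h.symm (hpos z).2
  have hcont : Continuous fun y => (fourierHat φ y).re :=
    Complex.continuous_re.comp (continuous_fourierHat hφ.integrable)
  obtain ⟨r, hr, hball⟩ := Metric.eventually_nhds_iff.1
    (hcont.continuousAt.eventually (lt_mem_nhds (half_lt_self hz0)))
  refine ⟨_, half_pos hz0, z, r / 2, half_pos hr, fun y h1 h2 => (hball ?_).le⟩
  rw [Real.dist_eq, abs_lt]
  constructor <;> linarith

/-- The boundary behaviour with respect to one function with non-negative Fourier transform forces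
the error to be bounded: its averages against that non-negative kernel stay bounded, and by slow
decrease a large value of the error would persist over a whole interval. -/
theorem exists_abs_normalizedError_le (hS : LocallyIntegrableOn S (Ici 0))
    (hint : ∀ η > 0, IntegrableOn (fun x => Real.exp (-(η * x)) * normalizedError S a x) (Ioi 0))
    (hC : 0 ≤ C) (hx₀ : 0 ≤ x₀) (hlow : ∀ x, x₀ ≤ x → -C ≤ normalizedError S a x)
    (hgrow : ∀ x h, x₀ ≤ x → 0 ≤ h →
      Real.exp (-h) * (normalizedError S a x + a) - C ≤ normalizedError S a (x + h))
    (hφ : MemWienerAlgebraCompact φ) (h0 : φ 0 ≠ 0)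
    (hpos : ∀ x, 0 ≤ (fourierHat φ x).re ∧ (fourierHat φ x).im = 0)
    (hps : PseudofunctionBoundaryBehaviorWrt
      (fun s : ℂ => laplaceTransform S s - (a : ℂ) / (s - 1)) 1 φ) :
    ∃ X M, 0 ≤ X ∧ ∀ x, X < x → |normalizedError S a x| ≤ M := by
  obtain ⟨c, hc, u, l, hl, hcl⟩ := hφ.exists_fourierHat_ge h0 hpos
  obtain ⟨-, N, -, I, hI, hI0⟩ := hps
  obtain ⟨N', hN'⟩ := eventually_atTop.1 (NormedAddGroup.tendsto_nhds_zero.1 hI0 1 one_pos)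
  set q : ℝ → ℝ := fun x => (fourierHat φ x).re with hq
  have hq0 : ∀ x, 0 ≤ q x := fun x => (hpos x).1
  have hqi : Integrable q := hφ.integrable_fourierHat.re
  have hqφ : ∀ x, fourierHat φ x = (q x : ℂ) := fun x => Complex.ext rfl (by simpa using (hpos x).2)
  set K := ∫ t, ‖φ t‖ with hK
  have hK0 : 0 ≤ K := integral_nonneg fun _ => norm_nonneg _
  have hqK : ∀ x, q x ≤ K := fun x =>
    (Complex.re_le_norm _).trans (norm_fourierHat_le φ x)
  set B := C * (∫ x, q x) + K * ∫ x in Ioc 0 x₀, |normalizedError S a x| with hB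
  have hDi : IntegrableOn (fun x => |normalizedError S a x|) (Ioc 0 x₀) :=
    (integrableOn_normalizedError hS a x₀).norm
  -- by slow decrease the value at `A` persists over `[A, A + l]`, where the kernel is at least `c`;
  -- everything else lowers the average by at most the constant `B`
  have hmain : ∀ σ > 1, ∀ h A, h + u = A → x₀ < A → 0 ≤ normalizedError S a A + a →
      l * (c * Real.exp (-l) * (normalizedError S a A + a) * Real.exp (-((σ - 1) * (A + l)))) - B ≤
        (∫ t : ℝ, (laplaceTransform S (σ + t * Complex.I) - (a : ℂ) / (σ + t * Complex.I - 1)) *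
        Complex.exp (Complex.I * h * t) * φ t).re := by
    intro σ hσ h A hA hx₀A hTA
    have hη : 0 < σ - 1 := sub_pos.2 hσ
    set m := c * Real.exp (-l) * (normalizedError S a A + a) * Real.exp (-((σ - 1) * (A + l)))
      with hm
    have hm0 : 0 ≤ m := by positivity
    have hA0 : 0 < A := hx₀.trans_lt hx₀A
    rw [integral_laplace_mul_eq hS hint hφ.integrable hσ h]
    have hreal : (∫ x in Ioi (0 : ℝ),
        ((Real.exp (-((σ - 1) * x)) * normalizedError S a x : ℝ) : ℂ) * fourierHat φ (x - h)).re =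
        ∫ x in Ioi (0 : ℝ), Real.exp (-((σ - 1) * x)) * normalizedError S a x * q (x - h) := by
      rw [← Complex.ofReal_re (∫ x in Ioi (0 : ℝ), Real.exp _ * _ * _), ← integral_complex_ofReal]
      congr 2
      ext x
      rw [hqφ, ← Complex.ofReal_mul]
    rw [hreal]
    have hi1 : IntegrableOn ((Icc A (A + l)).indicator fun _ => m) (Ioi 0) :=
      ((integrable_indicator_iff measurableSet_Icc).2 (integrableOn_const (by simp))).integrableOn
    have hi2 : IntegrableOn (fun x => C * q (x - h)) (Ioi 0) :=
      ((hqi.comp_sub_right h).const_mul C).integrableOn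
    have hi3 : IntegrableOn ((Ioc 0 x₀).indicator fun x => K * |normalizedError S a x|) (Ioi 0) :=
      ((integrable_indicator_iff measurableSet_Ioc).2 (hDi.const_mul K)).integrableOn
    have hi4 : IntegrableOn (fun x => Real.exp (-((σ - 1) * x)) * normalizedError S a x * q (x - h))
        (Ioi 0) :=
      (hint _ hη).mul_bdd (c := K) (hqi.comp_sub_right h).1.restrict (ae_of_all _ fun x => by
        rw [Real.norm_of_nonneg (hq0 _)]; exact hqK _)
    have hle : ∫ x in Ioi (0 : ℝ), ((Icc A (A + l)).indicator (fun _ => m) x - C * q (x - h) -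
        (Ioc 0 x₀).indicator (fun x => K * |normalizedError S a x|) x) ≤
        ∫ x in Ioi (0 : ℝ), Real.exp (-((σ - 1) * x)) * normalizedError S a x * q (x - h) := by
      refine setIntegral_mono_on ((hi1.sub hi2).sub hi3) hi4 measurableSet_Ioi fun x hx => ?_
      have hx0 : 0 < x := hx
      have he1 : Real.exp (-((σ - 1) * x)) ≤ 1 := Real.exp_le_one_iff.2 (by nlinarith)
      have he0 := Real.exp_pos (-((σ - 1) * x))
      have hCq : 0 ≤ C * q (x - h) := mul_nonneg hC (hq0 _)
      by_cases hxx : x ≤ x₀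
      · rw [indicator_of_notMem (fun h' => by linarith [h'.1]),
          indicator_of_mem (show x ∈ Ioc 0 x₀ from ⟨hx0, hxx⟩)]
        have h1 : |Real.exp (-((σ - 1) * x)) * normalizedError S a x * q (x - h)| ≤
            K * |normalizedError S a x| := by
          rw [abs_mul, abs_mul, Real.abs_exp, abs_of_nonneg (hq0 _), mul_comm K]
          exact mul_le_mul (mul_le_of_le_one_left (abs_nonneg _) he1) (hqK _) (hq0 _)
            (abs_nonneg _)
        linarith [(abs_le.1 h1).1]
      · push Not at hxx
        rw [indicator_of_notMem (s := Ioc 0 x₀) (fun h' => by linarith [h'.2]), sub_zero]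
        have hDC : 0 ≤ normalizedError S a x + C := by linarith [hlow x hxx.le]
        have hCe : Real.exp (-((σ - 1) * x)) * (C * q (x - h)) ≤ C * q (x - h) :=
          mul_le_of_le_one_left hCq he1
        have hmx : (Icc A (A + l)).indicator (fun _ => m) x ≤
            Real.exp (-((σ - 1) * x)) * ((normalizedError S a x + C) * q (x - h)) := by
          by_cases hxA : x ∈ Icc A (A + l)
          · rw [indicator_of_mem hxA]
            have h1 := hgrow A (x - A) hx₀A.le (sub_nonneg.2 hxA.1)
            rw [add_sub_cancel] at h1
            have h2 : Real.exp (-l) * (normalizedError S a A + a) ≤ normalizedError S a x + C := by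
              have h3 : Real.exp (-l) ≤ Real.exp (-(x - A)) :=
                Real.exp_le_exp.2 (by linarith [hxA.2])
              linarith [mul_le_mul_of_nonneg_right h3 hTA]
            have h4 : Real.exp (-((σ - 1) * (A + l))) ≤ Real.exp (-((σ - 1) * x)) :=
              Real.exp_le_exp.2 (by nlinarith [hxA.2])
            have h5 : c ≤ q (x - h) :=
              hcl (x - h) (by linarith [hxA.1]) (by linarith [hxA.2])
            have h6 : Real.exp (-l) * (normalizedError S a A + a) * c ≤
                (normalizedError S a x + C) * q (x - h) := mul_le_mul h2 h5 hc.le hDC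
            calc m = Real.exp (-((σ - 1) * (A + l))) *
                  (Real.exp (-l) * (normalizedError S a A + a) * c) := by rw [hm]; ring
              _ ≤ _ := mul_le_mul h4 h6 (by positivity) he0.le
          · rw [indicator_of_notMem hxA]
            exact mul_nonneg he0.le (mul_nonneg hDC (hq0 _))
        linarith
    have hi12 : IntegrableOn (fun x => (Icc A (A + l)).indicator (fun _ => m) x - C * q (x - h))
        (Ioi 0) := hi1.sub hi2
    refine le_trans ?_ hle
    rw [integral_sub hi12 hi3, integral_sub hi1 hi2,
      setIntegral_indicator measurableSet_Icc, setIntegral_indicator measurableSet_Ioc,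
      inter_eq_right.2 Ioc_subset_Ioi_self,
      inter_eq_right.2 (show Icc A (A + l) ⊆ Ioi 0 from fun x hx => hA0.trans_le hx.1),
      setIntegral_const, integral_const_mul, integral_const_mul, Real.volume_real_Icc,
      add_sub_cancel_left, max_eq_left hl.le, smul_eq_mul]
    have h7 : ∫ x in Ioi (0 : ℝ), q (x - h) ≤ ∫ x, q x := by
      rw [← integral_sub_right_eq_self q h]
      exact setIntegral_le_integral (hqi.comp_sub_right h) (ae_of_all _ fun x => hq0 _)
    have h8 := mul_le_mul_of_nonneg_left h7 hC
    rw [hB]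
    linarith
  have hbound : ∀ A, x₀ < A → N ≤ A - u → N' ≤ A - u → 0 ≤ normalizedError S a A + a →
      l * (c * Real.exp (-l) * (normalizedError S a A + a)) ≤ 1 + B := by
    intro A hA hN1 hN2 hTA
    have hre := (Complex.continuous_re.tendsto _).comp (hI (A - u) hN1)
    have hleft : Tendsto (fun σ : ℝ => l * (c * Real.exp (-l) * (normalizedError S a A + a) *
        Real.exp (-((σ - 1) * (A + l)))) - B) (𝓝[>] 1)
        (𝓝 (l * (c * Real.exp (-l) * (normalizedError S a A + a)) - B)) := by
      have h1 : Continuous fun σ : ℝ => l * (c * Real.exp (-l) * (normalizedError S a A + a) *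
        Real.exp (-((σ - 1) * (A + l)))) - B := by fun_prop
      have h2 := h1.tendsto 1
      simp only [sub_self, zero_mul, neg_zero, Real.exp_zero, mul_one] at h2
      exact h2.mono_left nhdsWithin_le_nhds
    have h3 := le_of_tendsto_of_tendsto hleft hre (by
      filter_upwards [self_mem_nhdsWithin] with σ hσ
      exact hmain σ hσ (A - u) A (by ring) hA hTA)
    have h4 := (Complex.re_le_norm (I (A - u))).trans (hN' _ hN2).le
    linarith
  have hlc : 0 < l * (c * Real.exp (-l)) := by positivity
  refine ⟨max x₀ (max (N + u) (N' + u)), max C (|a| + |1 + B| / (l * (c * Real.exp (-l)))),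
    hx₀.trans (le_max_left _ _), fun A hA => ?_⟩
  simp only [max_lt_iff] at hA
  obtain ⟨hA1, hA2, hA3⟩ := hA
  refine abs_le.2 ⟨?_, ?_⟩
  · linarith [hlow A hA1.le, le_max_left C (|a| + |1 + B| / (l * (c * Real.exp (-l))))]
  · refine le_trans ?_ (le_max_right _ _)
    have hnn : 0 ≤ |1 + B| / (l * (c * Real.exp (-l))) := by positivity
    rcases le_total 0 (normalizedError S a A + a) with hs | hs
    · have h1 := hbound A hA1 (by linarith) (by linarith) hs
      have h2 : normalizedError S a A + a ≤ |1 + B| / (l * (c * Real.exp (-l))) := by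
        rw [le_div_iff₀ hlc]
        linarith [le_abs_self (1 + B)]
      linarith [neg_abs_le a]
    · linarith [neg_abs_le a]

/-- For a bounded error, log-linear slow decrease is ordinary slow decrease of the error. -/
theorem LogLinearlySlowlyDecreasing.normalizedError_slowlyDecreasing
    (hslow : LogLinearlySlowlyDecreasing S) {X M : ℝ}
    (hM : ∀ x, X < x → |normalizedError S a x| ≤ M) :
    ∀ ε > 0, ∃ δ > 0, ∃ Y, X < Y ∧ ∀ x h, Y ≤ x → 0 ≤ h → h ≤ δ →
      normalizedError S a x - ε ≤ normalizedError S a (x + h) := by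
  intro ε hε
  have hM0 : 0 ≤ M := (abs_nonneg _).trans (hM (X + 1) (lt_add_one X))
  obtain ⟨δ, hδ, x₀, hx₀⟩ := hslow (ε / 2) (half_pos hε)
  have hQ : 0 < 2 * (M + |a| + 1) := by positivity
  refine ⟨min δ (ε / (2 * (M + |a| + 1))), by positivity, max x₀ (X + 1),
    (lt_add_one X).trans_le (le_max_right _ _), fun x h hx h0 hh => ?_⟩
  have hxX : X < x := (lt_add_one X).trans_le ((le_max_right _ _).trans hx)
  have h1 := hx₀ x h ((le_max_left _ _).trans hx) h0 (hh.trans (min_le_left _ _))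
  have h2 : h * (2 * (M + |a| + 1)) ≤ ε := (le_div_iff₀ hQ).1 (hh.trans (min_le_right _ _))
  rw [le_div_iff₀ (Real.exp_pos x), ← normalizedError_add_mul_exp S a (x + h),
    ← normalizedError_add_mul_exp S a x, Real.exp_add] at h1
  have h3 : -(ε / 2) ≤ (normalizedError S a (x + h) + a) * Real.exp h -
      (normalizedError S a x + a) := by
    refine le_of_mul_le_mul_right ?_ (Real.exp_pos x)
    linarith
  have h4 : normalizedError S a x + a - ε / 2 ≤ (normalizedError S a (x + h) + a) * Real.exp h := by
    linarith
  have h5 : (normalizedError S a x + a - ε / 2) * Real.exp (-h) ≤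
      normalizedError S a (x + h) + a := by
    have h6 := mul_le_mul_of_nonneg_right h4 (Real.exp_pos (-h)).le
    rwa [mul_assoc, ← Real.exp_add, add_neg_cancel, Real.exp_zero, mul_one] at h6
  have h7 : 0 ≤ 1 - Real.exp (-h) := by linarith [Real.exp_le_one_iff.2 (neg_nonpos.2 h0)]
  have h8 : 1 - Real.exp (-h) ≤ h := by linarith [Real.add_one_le_exp (-h)]
  have h9 : normalizedError S a x + a ≤ M + |a| := by
    linarith [(abs_le.1 (hM x hxX)).2, le_abs_self a]
  have h10 : (1 - Real.exp (-h)) * (normalizedError S a x + a) ≤ h * (M + |a|) :=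
    (mul_le_mul_of_nonneg_left h9 h7).trans
      (mul_le_mul_of_nonneg_right h8 (by positivity))
  nlinarith [Real.exp_pos (-h)]

end UpperBound

section Converse

open ContinuousLinearMap
open scoped Convolution FourierTransform

/-- The Tauberian direction. The boundary behaviour says that the averages of the error against
the kernels `fourierHat (φ j)` tend to zero; the error is bounded and slowly decreasing, and the
Fourier transforms `2π φ j (2π ·)` of these kernels have no common zero. -/
theorem tendsto_normalizedError_of_boundaryBehavior {J : Type*} {S : ℝ → ℝ} {a : ℝ}
    {φ : J → ℝ → ℂ} (hS : LocallyIntegrableOn S (Set.Ici 0))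
    (hφ : ∀ j : J, MemWienerAlgebraCompact (φ j)) (hne : ∀ t : ℝ, ∃ j : J, φ j t ≠ 0)
    (hzero : ∃ j : J, φ j 0 ≠ 0 ∧
      ∀ x : ℝ, 0 ≤ (fourierHat (φ j) x).re ∧ (fourierHat (φ j) x).im = 0)
    (hslow : LogLinearlySlowlyDecreasing S)
    (hconv : ∀ s : ℂ, 1 < s.re → LaplaceConverges S s)
    (hps : ∀ j : J, PseudofunctionBoundaryBehaviorWrt
      (fun s : ℂ => laplaceTransform S s - (a : ℂ) / (s - 1)) 1 (φ j)) :
    Tendsto (normalizedError S a) atTop (𝓝 0) := by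
  obtain ⟨j₀, hj0, hpos⟩ := hzero
  obtain ⟨C, hC, x₀, hx₀, hlow, hgrow⟩ := hslow.exists_normalizedError_ge a
  have hint : ∀ η > 0, IntegrableOn
      (fun x => Real.exp (-(η * x)) * normalizedError S a x) (Set.Ioi 0) :=
    fun η hη => integrableOn_exp_mul_of_laplaceConverges hS hx₀ hlow hconv hη
  obtain ⟨X, M, hX, hM⟩ := exists_abs_normalizedError_le hS hint hC hx₀ hlow hgrow
    (hφ j₀) hj0 hpos (hps j₀)
  have hM0 : 0 ≤ M := (abs_nonneg _).trans (hM (X + 1) (lt_add_one X))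
  have hker : ∀ j, Tendsto
      ((fun x => (((Set.Ioi X).indicator (normalizedError S a) x : ℝ) : ℂ))
        ⋆[mul ℂ ℂ] fun x => fourierHat (φ j) (-x)) atTop (𝓝 0) := by
    intro j
    rw [← tendsto_average_iff hS hX hM (hφ j)]
    obtain ⟨-, N, -, I, hI, hI0⟩ := hps j
    refine hI0.congr' ?_
    filter_upwards [eventually_ge_atTop N] with h hh
    exact tendsto_nhds_unique (hI h hh)
      (tendsto_integral_laplace_mul hS hX hM (hφ j) h)
  have hfne : ∀ u, ∃ j, 𝓕 (fun x => fourierHat (φ j) (-x)) u ≠ 0 := by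
    intro u
    obtain ⟨j, hj⟩ := hne (2 * Real.pi * u)
    refine ⟨j, ?_⟩
    rw [(hφ j).fourier_fourierHat_neg]
    exact mul_ne_zero (by simp [Real.pi_ne_zero]) hj
  have hlim := tendsto_zero_of_tendsto_convolution
    (aestronglyMeasurable_indicator_normalizedError hS a hX)
    (abs_indicator_normalizedError_le hM0 hM) ?_
    (fun j => (hφ j).integrable_fourierHat.comp_neg) hfne hker
  · refine hlim.congr' ?_
    filter_upwards [eventually_gt_atTop X] with x hx
    rw [Set.indicator_of_mem (show x ∈ Set.Ioi X from hx)]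
  · intro ε hε
    obtain ⟨δ, hδ, Y, hY, h⟩ := hslow.normalizedError_slowlyDecreasing hM ε hε
    refine ⟨δ, hδ, Y, fun x t hx ht0 ht => ?_⟩
    rw [Set.indicator_of_mem (show x ∈ Set.Ioi X from hY.trans_le hx),
      Set.indicator_of_mem (show x + t ∈ Set.Ioi X from Set.mem_Ioi.2 (by linarith))]
    exact h x t hx ht0 ht

end Converse

end WienerIkehara

theorem mainTheorem1 {J : Type*} (S : ℝ → ℝ) (a : ℝ) (φ : J → ℝ → ℂ)
    (hS : LocallyIntegrableOn S (Set.Ici 0))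
    (hφ : ∀ j : J, WienerIkehara.MemWienerAlgebraCompact (φ j))
    (hne : ∀ t : ℝ, ∃ j : J, φ j t ≠ 0)
    (hzero : ∃ j : J, φ j 0 ≠ 0 ∧
      ∀ x : ℝ, 0 ≤ (WienerIkehara.fourierHat (φ j) x).re ∧
        (WienerIkehara.fourierHat (φ j) x).im = 0) :
    Tendsto (fun x : ℝ => S x / Real.exp x) atTop (𝓝 a) ↔
      WienerIkehara.LogLinearlySlowlyDecreasing S ∧
      (∀ s : ℂ, 1 < s.re → WienerIkehara.LaplaceConverges S s) ∧
      (∀ j : J, WienerIkehara.PseudofunctionBoundaryBehaviorWrt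
        (fun s : ℂ => WienerIkehara.laplaceTransform S s - (a : ℂ) / (s - 1)) 1 (φ j)) := by
  have hiff : Tendsto (fun x : ℝ => S x / Real.exp x) atTop (𝓝 a) ↔
      Tendsto (WienerIkehara.normalizedError S a) atTop (𝓝 0) :=
    tendsto_sub_nhds_zero_iff.symm
  rw [hiff]
  constructor
  · intro hlim
    obtain ⟨X, hX⟩ := eventually_atTop.1
      (NormedAddGroup.tendsto_nhds_zero.1 hlim 1 one_pos)
    have hM : ∀ x, max X 0 < x → |WienerIkehara.normalizedError S a x| ≤ 1 := fun x hx =>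
      (hX x ((le_max_left X 0).trans hx.le)).le
    refine ⟨WienerIkehara.logLinearlySlowlyDecreasing_of_tendsto hlim, fun s hs => ⟨_,
      WienerIkehara.tendsto_laplacePartial hS (fun η hη =>
        WienerIkehara.integrableOn_exp_mul_normalizedError hS (le_max_right X 0) hM hη) hs⟩,
      fun j => WienerIkehara.pseudofunctionBoundaryBehavior_of_tendsto hS (le_max_right X 0) hM
        hlim (hφ j)⟩
  · rintro ⟨hslow, hconv, hps⟩
    exact WienerIkehara.tendsto_normalizedError_of_boundaryBehavior hS hφ hne hzero hslow hconv hps
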